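/- **Model.** A connected network graph $G$ on $n$ nodes has hop distance $d$. There are finitely many links, each either valid or an in-band wormhole link. Source $i$ ($i$ in a finite set) splits a rate $r_i$ over a finite nonempty set $\mathcal P_i$ of paths, a path being a finite set of links. A flow allocation $\mathbf r=(r_P)$ is feasible if $r_P\ge 0$ and $\sum_{P\in\mathcal P_i}r_P=r_i$ for all $i$; its link rates are $r_l=\sum_{P\ni l}r_P$. Each link $l$ has a nonnegative, strictly increasing delay function $f_l$ on $[0,\infty)$. *Wormhole links.* A wormhole link $l$ joins two distinct nodes $W_1,W_2$. For a set $\mathcal C$ of compromised nodes let $\tilde{\mathcal C}=\{w\in\mathcal C: d(W_1,w)<d(W_2,w)+3\}$ and let $m(\mathcal C)=\min_{w\in\tilde{\mathcal C}}(d(W_1,w)+d(w,W_2))$, with $m(\mathcal C)=M_l$ if $\tilde{\mathcal C}=\emptyset$, where $M_l$ is a constant at least as large as $d(W_1,w)+d(w,W_2)$ for every node $w$ with $d(W_1,w)<d(W_2,w)+3$. The function $\beta_l:[0,1]\to(0,\infty)$ is $C^1$, and $\beta_l(k/n)$ is the expectation of $m(\mathcal C)$ for $\mathcal C$ uniform among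 the $k$-element sets of nodes, $k=0,\dots,n$. The fraction $x_l(t)\in[0,1]$ of compromised nodes follows gradient ascent for the utility $n-\beta_l(x)-c_Ax$ with cost $c_A>0$: $\dot x_l=(-\beta_l'(x_l)-c_A)_+$. *Detection.* Let $w_l(s,p)$ be the posterior probability (Bayes' rule) that link $l$ is a wormhole given rate $s$ and delay $p$, let $\overline w$ be a threshold and $K\ge0$ a penalty. The price of $l$ is $y_l=p_l+K\,\mathbf 1(w_l(r_l,p_l)>\overline w)$ with $p_l=f_l(r_l)$ for a valid link and $p_l=\beta_l(x_l)f_l(r_l)$ for a wormhole link. It is assumed that the indicator is nondecreasing in the link rate $r_l$ (for each fixed $x_l$) and, for wormhole links, nondecreasing in the delay $p$ for each fixed rate. *Source dynamics.* With path delays $q_P=\sum_{l\in P}y_l$ and $P_i^{\min}\in\arg\min_{P\in\mathcal P_i}q_P$, $$\dot r_P=-\{q_P-q_{P_i^{\min}}\}_+^{r_P}\ (P\ne P_i^{\min}),\qquad \dot r_{P_i^{\min}}=-\sum_{P\in\mathcal P_i,\,P\neq P_i^{\min}}\dot r_P,$$ where $\{y\}_+^{\rho}=0$ if $y>0$ and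 $\rho=0$, and $\{y\}_+^\rho=y$ otherwise. Since the right-hand side is discontinuous, solutions are understood in a relaxed sense that contains all Carathéodory solutions with feasible allocations: $\mathbf r$ is absolutely continuous on bounded intervals, $\mathbf r(0)$ is feasible, $x_l(t)\in[0,1]$ for all $t\ge 0$, the equations for $x_l$ hold for all $t\ge0$, and the equations for $\mathbf r$ hold for almost every $t\ge 0$, where (a) where the price jumps as a function of $r_l$, any value between its one-sided limits may be used (limits along rates $\geq 0$, the value at the jump being included), and (b) convex combinations, source by source, of the velocities belonging to the different choices of $P_i^{\min}$ are allowed. *Equilibria.* $(\mathbf r^*,x^*)$ is an equilibrium if $x_l^*\in[0,1]$ and $(-\beta_l'(x_l^*)-c_A)_+=0$ for every wormhole link $l$, $\mathbf r^*$ is feasible, and $\mathbf r^*$ is a Wardrop equilibrium for every source ($r_P^*>0$ implies $q_P\le q_{P'}$ for all $P'\in\mathcal P_i$) for some prices given by $y_l$ at $(r^*_l,x^*_l)$, where, if $y_l$ is discontinuous there, the price may be any value between the lower and the upper limit of $y_l$ at that point, as a function of $r_l\ge 0$ (valid links) or of $(r_l,x_l)\in[0,\infty)\times[0,1]$ (wormhole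 links). **Theorem.** For every solution $(\mathbf r(t),x(t))$, $t\ge0$, there is an equilibrium $(\mathbf r^*,x^*)$ such that, as $t\to\infty$: 1. $x(t)\to x^*$, and $r_l(t)\to r_l^*$ for every link $l$. 2. The distance of $\mathbf r(t)$ to the set of all $\mathbf r'$ that have the same link rates as $\mathbf r^*$ and for which $(\mathbf r',x^*)$ is an equilibrium tends to $0$. 3. If $\mathbf r^*$ is the only element of that set (in particular if the equilibrium flow allocation at $x^*$ is unique), then $\lim_{t\to\infty}\mathbf r_i(t)=\mathbf r_i^*$ for every source $i$. 4. If for every wormhole link $l$ and all but countably many $s\ge0$ the price at link rate $s$ is continuous in $x_l\in[0,1]$ at $x_l^*$, then all $\mathbf r'$ for which $(\mathbf r',x^*)$ is an equilibrium have the same link rates. -/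

import Mathlib

open Set Filter Topology MeasureTheory

noncomputable section

/-! ### Expected length of an in-band wormhole tunnel -/

section Tunnel

variable {V : Type*}

/-- Number of hops of the tunnel from `a` to `b` routed through the third colluding node `c`. -/
def tunnelLength (G : SimpleGraph V) (a b c : V) : ℕ := G.dist a c + G.dist c b

/-- The compromised nodes that can serve as the intermediate node of a tunnel from `a` to `b`
without wormhole collapse. -/
def collapseFree (G : SimpleGraph V) (a b : V) (C : Finset V) : Finset V :=
  C.filter (fun c => G.dist a c < G.dist b c + 3)

/-- The shortest collapse-free tunnel from `a` to `b` available to an adversary holding the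
compromised set `C`; the value `M` is assigned if no such tunnel exists. -/
def shortestTunnel (G : SimpleGraph V) (a b : V) (M : ℝ) (C : Finset V) : ℝ :=
  if h : (collapseFree G a b C).Nonempty then
    (((collapseFree G a b C).inf' h (tunnelLength G a b) : ℕ) : ℝ)
  else M

/-- Expectation of the shortest tunnel length when the compromised set is uniformly distributed
over the sets of `k` nodes. -/
def expectedTunnel [Fintype V] (G : SimpleGraph V) (a b : V) (M : ℝ) (k : ℕ) : ℝ :=
  (∑ C ∈ Finset.powersetCard k (Finset.univ : Finset V), shortestTunnel G a b M C) /
    ((Fintype.card V).choose k : ℝ)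

end Tunnel

/-! ### Source dynamics -/

section Source

variable {Q : Type*}

/-- The projection `{y}_+^ρ`, which stops the decrease of a path rate `ρ` that has reached zero.
Rates are nonnegative, so `ρ ≤ 0` means `ρ = 0`; writing `ρ ≤ 0` makes the nonnegativity of the
rates a consequence of the dynamics instead of a constraint on its solutions. -/
def posProj (y ρ : ℝ) : ℝ :=
  open Classical in if 0 < y ∧ ρ ≤ 0 then 0 else y

/-- Velocity of the path rates of one source with path delays `q` and path rates `ρ`, when the
path `m` is the selected path of minimum delay. -/
def flowField [Fintype Q] (q ρ : Q → ℝ) (m : Q) : Q → ℝ := fun P =>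
  open Classical in
  if P = m then ∑ P' ∈ Finset.univ.erase m, posProj (q P' - q m) (ρ P')
  else -posProj (q P - q m) (ρ P)

/-- The paths of minimum delay. -/
def minDelayPaths (q : Q → ℝ) : Set Q := {m | ∀ P, q m ≤ q P}

/-- Velocities obtained by mixing the selections of the minimum-delay path. For a single selected
path this is `flowField` itself; mixtures describe the sliding motion along ties. -/
def flowVelocities [Fintype Q] (q ρ : Q → ℝ) : Set (Q → ℝ) :=
  convexHull ℝ (flowField q ρ '' minDelayPaths q)

/-- `ρ` is a Wardrop equilibrium for the path delays `q`. -/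
def IsWardrop (q ρ : Q → ℝ) : Prop := ∀ P, 0 < ρ P → ∀ P', q P ≤ q P'

end Source

/-- Krasovskii regularization at the point `a` of a possibly discontinuous real function `g` with
domain `S`. It contains `g a` if `a ∈ S`, and is `{g a}` where `g` is continuous on `S`. -/
def krasovskii {X : Type*} [PseudoMetricSpace X] (g : X → ℝ) (S : Set X) (a : X) : Set ℝ :=
  ⋂ ε ∈ Ioi (0 : ℝ), closure (convexHull ℝ (g '' (Metric.ball a ε ∩ S)))

/-! ### The network under in-band wormhole attack and statistical detection -/

/-- Data of the network. `V` is the set of nodes, `Lv` the set of valid links, `Lw` the set of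
in-band wormhole links, `ι` the set of source-destination pairs and `Path i` the set of paths
used by source `i`. -/
structure InBandNetwork (V Lv Lw ι : Type*) (Path : ι → Type*) where
  /-- direct radio links between nodes; it determines the hop distance -/
  G : SimpleGraph V
  /-- the links of each path -/
  links : ∀ i, Path i → Finset (Lv ⊕ Lw)
  /-- total rate of each source -/
  rate : ι → ℝ
  /-- link delay as a function of the link rate -/
  delay : Lv ⊕ Lw → ℝ → ℝ
  /-- first end of each wormhole tunnel -/
  W₁ : Lw → V
  /-- second end of each wormhole tunnel -/
  W₂ : Lw → V
  /-- value assigned to the tunnel length when no collapse-free tunnel exists -/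
  noTunnel : Lw → ℝ
  /-- expected tunnel length as a function of the fraction of compromised nodes -/
  β : Lw → ℝ → ℝ
  /-- the adversary's unit cost of compromising nodes -/
  cA : ℝ
  /-- penalty added to the price of a suspected link -/
  K : ℝ
  /-- detection threshold -/
  wbar : ℝ
  /-- prior probability that a link is a wormhole -/
  prior : Lv ⊕ Lw → ℝ
  /-- likelihood of the pair (link rate, link delay) if the link is a wormhole -/
  likWorm : Lv ⊕ Lw → ℝ → ℝ → ℝ
  /-- likelihood of the pair (link rate, link delay) if the link is valid -/
  likValid : Lv ⊕ Lw → ℝ → ℝ → ℝ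

namespace InBandNetwork

variable {V Lv Lw ι : Type*} {Path : ι → Type*} (N : InBandNetwork V Lv Lw ι Path)

/-- Posterior probability, by Bayes' rule, that link `l` is a wormhole, given its rate `s` and its
delay `p`. -/
def belief (l : Lv ⊕ Lw) (s p : ℝ) : ℝ :=
  N.prior l * N.likWorm l s p /
    (N.prior l * N.likWorm l s p + (1 - N.prior l) * N.likValid l s p)

/-- Detection indicator `𝟏(w_l > wbar)`. -/
def alarm (l : Lv ⊕ Lw) (s p : ℝ) : ℝ :=
  open Classical in if N.wbar < N.belief l s p then 1 else 0

/-- Price of a valid link at link rate `s`. -/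
def validPrice (l : Lv) (s : ℝ) : ℝ :=
  N.delay (Sum.inl l) s + N.K * N.alarm (Sum.inl l) s (N.delay (Sum.inl l) s)

/-- Price of a wormhole link at link rate `s` and fraction `x` of compromised nodes. -/
def wormPrice (l : Lw) (s x : ℝ) : ℝ :=
  N.β l x * N.delay (Sum.inr l) s +
    N.K * N.alarm (Sum.inr l) s (N.β l x * N.delay (Sum.inr l) s)

/-- Standing assumptions on the network. -/
structure Standing [Fintype V] : Prop where
  connected : N.G.Connected
  ends_ne : ∀ l, N.W₁ l ≠ N.W₂ l
  delay_strictMono : ∀ l, StrictMonoOn (N.delay l) (Ici 0)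
  delay_nonneg : ∀ l, ∀ s, 0 ≤ s → 0 ≤ N.delay l s
  noTunnel_ge : ∀ l, ∀ c ∈ collapseFree N.G (N.W₁ l) (N.W₂ l) Finset.univ,
    (tunnelLength N.G (N.W₁ l) (N.W₂ l) c : ℝ) ≤ N.noTunnel l
  /-- at the fractions `k / n`, `β` is the expected length of the shortest tunnel -/
  β_eq : ∀ l, ∀ k : ℕ, k ≤ Fintype.card V →
    N.β l ((k : ℝ) / (Fintype.card V : ℝ)) =
      expectedTunnel N.G (N.W₁ l) (N.W₂ l) (N.noTunnel l) k
  /-- between these fractions, `β` interpolates smoothly by positive values -/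
  β_contDiff : ∀ l, ContDiffOn ℝ 1 (N.β l) (Icc 0 1)
  β_pos : ∀ l, ∀ x ∈ Icc (0 : ℝ) 1, 0 < N.β l x
  cA_pos : 0 < N.cA
  K_nonneg : 0 ≤ N.K
  prior_mem : ∀ l, N.prior l ∈ Icc (0 : ℝ) 1
  likWorm_nonneg : ∀ l s p, 0 ≤ N.likWorm l s p
  likValid_nonneg : ∀ l s p, 0 ≤ N.likValid l s p
  /-- the detection indicator is nondecreasing in the link rate -/
  alarm_mono_valid : ∀ l : Lv, MonotoneOn
    (fun s => N.alarm (Sum.inl l) s (N.delay (Sum.inl l) s)) (Ici 0)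
  alarm_mono_worm : ∀ l : Lw, ∀ x ∈ Icc (0 : ℝ) 1, MonotoneOn
    (fun s => N.alarm (Sum.inr l) s (N.β l x * N.delay (Sum.inr l) s)) (Ici 0)
  /-- longer delays are more suspicious -/
  alarm_mono_delay : ∀ l : Lw, ∀ s, 0 ≤ s → MonotoneOn (N.alarm (Sum.inr l) s) (Ici 0)

/-- Velocity of the fraction of compromised nodes: gradient ascent, restricted to nonnegative
velocities, for the utility `n - β x - cA * x`. -/
def compromiseRate (l : Lw) (x : ℝ) : ℝ :=
  max (-derivWithin (N.β l) (Icc 0 1) x - N.cA) 0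

/-- Prices of link `l` at link rate `z` and fractions `x` of compromised nodes: the actual price
and, at a jump of the price as a function of the link rate, the values in between. -/
def priceSet (z : ℝ) (x : Lw → ℝ) : Lv ⊕ Lw → Set ℝ
  | Sum.inl l => krasovskii (N.validPrice l) (Ici 0) z
  | Sum.inr l => krasovskii (fun s => N.wormPrice l s (x l)) (Ici 0) z

/-- Prices of link `l` in steady state, where the price of a wormhole link is regularized as a
function of both state variables, the link rate and the fraction of compromised nodes. -/
def steadyPriceSet (z : ℝ) (x : Lw → ℝ) : Lv ⊕ Lw → Set ℝ
  | Sum.inl l => krasovskii (N.validPrice l) (Ici 0) z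
  | Sum.inr l => krasovskii (fun a : ℝ × ℝ => N.wormPrice l a.1 a.2)
      (Ici 0 ×ˢ Icc 0 1) (z, x l)

/-- Delay of the paths of source `i` under the link prices `p`. -/
def pathDelay (p : Lv ⊕ Lw → ℝ) (i : ι) (P : Path i) : ℝ := ∑ l ∈ N.links i P, p l

section Flows

variable [Fintype ι] [∀ i, Fintype (Path i)]

/-- Total rate of link `l` under the path rates `r`. -/
def linkRate (r : ∀ i, Path i → ℝ) (l : Lv ⊕ Lw) : ℝ :=
  open Classical in ∑ i, ∑ P, if l ∈ N.links i P then r i P else 0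

/-- Feasible flow allocations. -/
def Feasible (r : ∀ i, Path i → ℝ) : Prop :=
  (∀ i P, 0 ≤ r i P) ∧ ∀ i, ∑ P, r i P = N.rate i

/-- Solutions on `[0, ∞)`, in the sense of Carathéodory, of the source rate dynamics in feedback
with the wormhole link dynamics. -/
structure IsSolution (r : ℝ → ∀ i, Path i → ℝ) (x : ℝ → Lw → ℝ) : Prop where
  init : N.Feasible (r 0)
  absCont : ∀ T, 0 ≤ T → AbsolutelyContinuousOnInterval r 0 T
  flow : ∀ᵐ t ∂(volume.restrict (Ici (0 : ℝ))), ∃ p : Lv ⊕ Lw → ℝ,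
    (∀ l, p l ∈ N.priceSet (N.linkRate (r t) l) (x t) l) ∧
    ∃ v : ∀ i, Path i → ℝ, HasDerivAt r v t ∧
      ∀ i, v i ∈ flowVelocities (N.pathDelay p i) (r t i)
  fraction : ∀ t, 0 ≤ t → ∀ l, x t l ∈ Icc (0 : ℝ) 1
  compromise : ∀ t, 0 ≤ t → ∀ l,
    HasDerivWithinAt (fun τ => x τ l) (N.compromiseRate l (x t l)) (Ici 0) t

/-- Equilibria `(r, x)`: the fractions of compromised nodes are at rest and the feasible flow
allocation is a Wardrop equilibrium of every source for the resulting prices. -/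
def IsEquilibrium (r : ∀ i, Path i → ℝ) (x : Lw → ℝ) : Prop :=
  (∀ l, x l ∈ Icc (0 : ℝ) 1 ∧ N.compromiseRate l (x l) = 0) ∧
  N.Feasible r ∧
  ∃ p : Lv ⊕ Lw → ℝ,
    (∀ l, p l ∈ N.steadyPriceSet (N.linkRate r l) x l) ∧
    ∀ i, IsWardrop (N.pathDelay p i) (r i)

end Flows

/-- Detection does not switch exactly at the fractions `x`: for all but countably many link rates
the price of a wormhole link is continuous in the fraction of compromised nodes at `x`. -/
def NonSwitching (x : Lw → ℝ) : Prop :=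
  ∀ l, {s : ℝ | 0 ≤ s ∧
    ¬ ContinuousWithinAt (fun ξ => N.wormPrice l s ξ) (Icc 0 1) (x l)}.Countable

end InBandNetwork

end

open Set Filter Topology MeasureTheory

noncomputable section

/-! ### Values of a monotone function between its one-sided limits -/

/-! The fractions decouple from the flows. Each `x l` is nondecreasing and bounded, with velocity a
continuous function of `x l`, hence converges to a rest point. It moves only where `β' < -cA < 0`,
so `β` decreases along the motion, and since longer delays are more suspicious every price at a
fixed rate decreases in time. The prices thus converge pointwise to strictly increasing functions
`Y` (`exists_limit_price`). `Y` need not be the price at the limit fractions, because detection may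
switch exactly there; this is why steady prices are regularized jointly in rate and fraction.

The Lyapunov function is the Beckmann potential of the current prices at the current link rates
(`energy`). It falls because prices fall and because sources leave expensive paths: its derivative,
where it exists, is at most minus the total dissipation (`deriv_energy_le`). It may jump downwards,
but its increments are bounded above linearly, which suffices to integrate this bound
(`sub_le_of_ae_deriv_le`). As the energy is nonnegative, the dissipation is small at arbitrarily
late times, and compactness gives a limit `(rs, ps)` of flows and prices that is Wardrop
(`exists_seq_tendsto_isWardrop`).

To pass to the whole trajectory (`tendsto_linkRate`), monotonicity of the energy shows that no
cluster point has a larger `Y`-potential than `rs`. The prices `ps` are a subgradient of the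
strictly convex `Y`-potential at the link rates of `rs`, and the Wardrop property makes this
subgradient nonnegative towards every feasible flow. So `rs` is a minimizer with unique link rates.
The Wardrop property under `ps` passes to every feasible flow with these link rates, which gives the
distance statement. Without switching, steady prices are values of a strictly monotone graph, and
adding two variational inequalities gives uniqueness. -/

/-- `p` lies between the one-sided limits at `z` of the price function `g` on `[0, ∞)`. -/
def PriceBetween (g : ℝ → ℝ) (z p : ℝ) : Prop :=
  (∀ s, 0 ≤ s → s < z → g s ≤ p) ∧ ∀ s, z < s → p ≤ g s

theorem le_of_mem_krasovskii {X : Type*} [PseudoMetricSpace X] {g : X → ℝ} {S : Set X} {a : X}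
    {p c ε : ℝ} (hp : p ∈ krasovskii g S a) (hε : 0 < ε)
    (h : ∀ b ∈ S, dist b a < ε → g b ≤ c) : p ≤ c := by
  have h1 := mem_iInter₂.1 hp ε hε
  refine (closure_minimal (convexHull_min ?_ (convex_Iic c)) isClosed_Iic) h1
  rintro _ ⟨b, ⟨hb, hbS⟩, rfl⟩
  exact h b hbS hb

theorem ge_of_mem_krasovskii {X : Type*} [PseudoMetricSpace X] {g : X → ℝ} {S : Set X} {a : X}
    {p c ε : ℝ} (hp : p ∈ krasovskii g S a) (hε : 0 < ε)
    (h : ∀ b ∈ S, dist b a < ε → c ≤ g b) : c ≤ p := by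
  have h1 := mem_iInter₂.1 hp ε hε
  refine (closure_minimal (convexHull_min ?_ (convex_Ici c)) isClosed_Ici) h1
  rintro _ ⟨b, ⟨hb, hbS⟩, rfl⟩
  exact h b hbS hb

/-- The Krasovskii regularization is upper semicontinuous, also along slices of the domain. -/
theorem mem_krasovskii_of_tendsto {X Y : Type*} [PseudoMetricSpace X] [PseudoMetricSpace Y]
    {g : Y → ℝ} {S : Set X} {T : Set Y} {j : ℕ → X → Y} {z : ℕ → X} {a : Y} {p : ℕ → ℝ} {q : ℝ}
    (hj : ∀ n u v, dist (j n u) (j n v) ≤ dist u v) (hS : ∀ n, MapsTo (j n) S T)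
    (hz : Tendsto (fun n => j n (z n)) atTop (𝓝 a)) (hp : Tendsto p atTop (𝓝 q))
    (h : ∀ n, p n ∈ krasovskii (fun u => g (j n u)) S (z n)) : q ∈ krasovskii g T a := by
  refine mem_iInter₂.2 fun ε hε => ?_
  have hε2 : 0 < ε / 2 := half_pos hε
  refine isClosed_closure.mem_of_tendsto hp ?_
  filter_upwards [(Metric.tendsto_nhds.1 hz) (ε / 2) hε2] with n hn
  -- `j n` does not increase distances, so it maps the `ε / 2`-ball about `z n` into the `ε`-ball
  -- about `a`.
  refine closure_mono (convexHull_mono ?_) (mem_iInter₂.1 (h n) (ε / 2) hε2)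
  rintro _ ⟨u, ⟨hu, huS⟩, rfl⟩
  refine ⟨j n u, ⟨?_, hS n huS⟩, rfl⟩
  have := dist_triangle (j n u) (j n (z n)) a
  have h2 := hj n u (z n)
  rw [Metric.mem_ball] at hu ⊢
  linarith

theorem PriceBetween.of_mem_krasovskii {g : ℝ → ℝ} (hg : MonotoneOn g (Ici 0)) {z p : ℝ}
    (hp : p ∈ krasovskii g (Ici 0) z) : PriceBetween g z p := by
  refine ⟨fun s hs hsz => ge_of_mem_krasovskii hp (sub_pos.2 hsz) fun b hb hbz => hg hs hb ?_,
    fun s hs => le_of_mem_krasovskii hp (sub_pos.2 hs) fun b hb hbz => hg hb ?_ ?_⟩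
  · rw [Real.dist_eq] at hbz; linarith [(abs_lt.1 hbz).1]
  · rw [Real.dist_eq] at hbz; exact (mem_Ici.1 hb).trans (by linarith [(abs_lt.1 hbz).2])
  · rw [Real.dist_eq] at hbz; linarith [(abs_lt.1 hbz).2]

theorem PriceBetween.self {g : ℝ → ℝ} (hg : MonotoneOn g (Ici 0)) {z : ℝ} (hz : 0 ≤ z) :
    PriceBetween g z (g z) :=
  ⟨fun _ hs hsz => hg hs hz hsz.le, fun _ hs => hg hz (hz.trans hs.le) hs.le⟩

theorem intervalIntegrable_of_monotoneOn_Ici {g : ℝ → ℝ} (hg : MonotoneOn g (Ici 0)) {a b : ℝ}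
    (ha : 0 ≤ a) (hb : 0 ≤ b) : IntervalIntegrable g volume a b :=
  (hg.mono fun _ hx => (le_inf ha hb).trans hx.1).intervalIntegrable

/-- Subgradient inequality for the convex primitive of `g`. Comparison on the open interval
suffices, so the value of `g` at the jump plays no role. -/
theorem PriceBetween.mul_sub_le_integral {g : ℝ → ℝ} (hg : MonotoneOn g (Ici 0)) {z z' p : ℝ}
    (hp : PriceBetween g z p) (hz : 0 ≤ z) (hz' : 0 ≤ z') :
    p * (z' - z) ≤ ∫ s in z..z', g s := by
  rcases le_total z z' with h | h
  · have := intervalIntegral.integral_mono_on_of_le_Ioo h (intervalIntegrable_const (c := p))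
      (intervalIntegrable_of_monotoneOn_Ici hg hz hz') fun s hs => hp.2 s hs.1
    simpa [mul_comm] using this
  · rw [intervalIntegral.integral_symm]
    have := intervalIntegral.integral_mono_on_of_le_Ioo h
      (intervalIntegrable_of_monotoneOn_Ici hg hz' hz) (intervalIntegrable_const (c := p))
      fun s hs => hp.1 s (hz'.trans hs.1.le) hs.2
    simp at this
    linarith

theorem PriceBetween.lt_of_lt {g : ℝ → ℝ} (hg : StrictMonoOn g (Ici 0)) {z p s : ℝ}
    (hp : PriceBetween g z p) (hz : 0 ≤ z) (hs : z < s) : p < g s := by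
  have h1 := hp.2 ((z + s) / 2) (by linarith)
  have h2 : g ((z + s) / 2) < g s :=
    hg (by simp only [mem_Ici]; linarith) (by simp only [mem_Ici]; linarith) (by linarith)
  linarith

theorem PriceBetween.gt_of_lt {g : ℝ → ℝ} (hg : StrictMonoOn g (Ici 0)) {z p s : ℝ}
    (hp : PriceBetween g z p) (hs0 : 0 ≤ s) (hs : s < z) : g s < p := by
  have h1 := hp.1 ((z + s) / 2) (by linarith) (by linarith)
  have h2 : g s < g ((z + s) / 2) :=
    hg hs0 (by simp only [mem_Ici]; linarith) (by linarith)
  linarith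

/-- Strict convexity: on the half next to `z` the slope `p` is used, on the other half the slope `g
m` at the midpoint, which differs strictly from `p` in the right direction. -/
theorem PriceBetween.mul_sub_lt_integral {g : ℝ → ℝ} (hg : StrictMonoOn g (Ici 0)) {z z' p : ℝ}
    (hp : PriceBetween g z p) (hz : 0 ≤ z) (hz' : 0 ≤ z') (hne : z ≠ z') :
    p * (z' - z) < ∫ s in z..z', g s := by
  set m := (z + z') / 2 with hm
  have hm0 : 0 ≤ m := by rw [hm]; positivity
  have h1 := hp.mul_sub_le_integral hg.monotoneOn hz hm0
  have h2 := (PriceBetween.self hg.monotoneOn hm0).mul_sub_le_integral hg.monotoneOn hm0 hz'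
  rw [← intervalIntegral.integral_add_adjacent_intervals
    (intervalIntegrable_of_monotoneOn_Ici hg.monotoneOn hz hm0)
    (intervalIntegrable_of_monotoneOn_Ici hg.monotoneOn hm0 hz')]
  rcases lt_or_gt_of_ne hne with h | h
  · have := hp.lt_of_lt hg hz (s := m) (by linarith)
    nlinarith
  · have := hp.gt_of_lt hg (s := m) hm0 (by linarith)
    nlinarith

/-- For distinct rates, the two strict subgradient inequalities with roles exchanged add up to a
positive product. -/
theorem PriceBetween.eq_of_mul_nonpos {g : ℝ → ℝ} (hg : StrictMonoOn g (Ici 0)) {z z' p p' : ℝ}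
    (hp : PriceBetween g z p) (hp' : PriceBetween g z' p') (hz : 0 ≤ z) (hz' : 0 ≤ z')
    (h : (p - p') * (z - z') ≤ 0) : z = z' := by
  by_contra hne
  have h1 := hp.mul_sub_lt_integral hg hz hz' hne
  have h2 := hp'.mul_sub_lt_integral hg hz' hz (Ne.symm hne)
  rw [intervalIntegral.integral_symm] at h2
  linarith

theorem PriceBetween.mul_nonneg {g : ℝ → ℝ} (hg : MonotoneOn g (Ici 0)) {z z' p p' : ℝ}
    (hp : PriceBetween g z p) (hp' : PriceBetween g z' p') (hz : 0 ≤ z) (hz' : 0 ≤ z') :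
    0 ≤ (p - p') * (z - z') := by
  have h1 := hp.mul_sub_le_integral hg hz hz'
  have h2 := hp'.mul_sub_le_integral hg hz' hz
  rw [intervalIntegral.integral_symm] at h2
  linarith

theorem PriceBetween.of_tendsto {g : ℕ → ℝ → ℝ} {G : ℝ → ℝ} {z p : ℕ → ℝ} {a q : ℝ}
    (hg : ∀ s, 0 ≤ s → Tendsto (fun n => g n s) atTop (𝓝 (G s))) (ha : 0 ≤ a)
    (hz : Tendsto z atTop (𝓝 a)) (hp : Tendsto p atTop (𝓝 q))
    (h : ∀ n, PriceBetween (g n) (z n) (p n)) : PriceBetween G a q := by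
  refine ⟨fun s hs hsa => le_of_tendsto_of_tendsto (hg s hs) hp ?_,
    fun s hs => le_of_tendsto_of_tendsto hp (hg s (ha.trans hs.le)) ?_⟩
  · filter_upwards [hz.eventually (lt_mem_nhds hsa)] with n hn using (h n).1 s hs hn
  · filter_upwards [hz.eventually (gt_mem_nhds hs)] with n hn using (h n).2 s hn

/-! ### Absolutely continuous and one-sidedly Lipschitz functions -/

theorem AbsolutelyContinuousOnInterval.lipschitzWith_comp {X Y : Type*} [PseudoMetricSpace X]
    [PseudoMetricSpace Y] {f : ℝ → X} {a b : ℝ} (hf : AbsolutelyContinuousOnInterval f a b)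
    {φ : X → Y} {K : NNReal} (hφ : LipschitzWith K φ) :
    AbsolutelyContinuousOnInterval (fun t => φ (f t)) a b := by
  rw [absolutelyContinuousOnInterval_iff] at hf ⊢
  intro ε hε
  -- `K + 1` instead of `K` avoids dividing by zero.
  obtain ⟨δ, hδ, h⟩ := hf (ε / (K + 1)) (by positivity)
  refine ⟨δ, hδ, fun E hE hEδ => ?_⟩
  calc ∑ i ∈ Finset.range E.1, dist (φ (f (E.2 i).1)) (φ (f (E.2 i).2))
      ≤ ∑ i ∈ Finset.range E.1, (K + 1) * dist (f (E.2 i).1) (f (E.2 i).2) :=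
        Finset.sum_le_sum fun i _ => (hφ.dist_le_mul _ _).trans (by gcongr; simp)
    _ = (K + 1) * ∑ i ∈ Finset.range E.1, dist (f (E.2 i).1) (f (E.2 i).2) := by
        rw [Finset.mul_sum]
    _ < (K + 1) * (ε / (K + 1)) := by gcongr; exact h E hE hEδ
    _ = ε := by field_simp

theorem AbsolutelyContinuousOnInterval.sub_le_of_deriv_le {f : ℝ → ℝ} {a b c : ℝ}
    (hf : AbsolutelyContinuousOnInterval f a b) (hab : a ≤ b)
    (h : ∀ᵐ t, t ∈ Ioc a b → deriv f t ≤ c) : f b - f a ≤ c * (b - a) := by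
  rw [← hf.integral_deriv_eq_sub]
  have := intervalIntegral.integral_mono_ae_restrict hab hf.intervalIntegrable_deriv
    (intervalIntegrable_const (c := c)) ((ae_restrict_iff' measurableSet_Icc).2 ?_)
  · simpa [mul_comm] using this
  · filter_upwards [h, Measure.ae_ne volume a] with t ht hta htab
    exact ht ⟨lt_of_le_of_ne htab.1 (Ne.symm hta), htab.2⟩

theorem AbsolutelyContinuousOnInterval.le_sub_of_le_deriv {f : ℝ → ℝ} {a b c : ℝ}
    (hf : AbsolutelyContinuousOnInterval f a b) (hab : a ≤ b)
    (h : ∀ᵐ t, t ∈ Ioc a b → c ≤ deriv f t) : c * (b - a) ≤ f b - f a := by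
  have := hf.neg.sub_le_of_deriv_le (c := -c) hab (by
    filter_upwards [h] with t ht htab
    rw [deriv.neg]; linarith [ht htab])
  simp only [Pi.neg_apply] at this
  linarith

/-- A function whose increments are bounded above decreases at least as much as its almost
everywhere defined derivative predicts. -/
theorem sub_le_of_ae_deriv_le {U : ℝ → ℝ} {a b C c : ℝ} (hab : a ≤ b)
    (hC : ∀ s ∈ Icc a b, ∀ t ∈ Icc a b, s ≤ t → U t - U s ≤ C * (t - s))
    (h : ∀ᵐ t, t ∈ Ioo a b → ∀ d, HasDerivAt U d t → d ≤ c) : U b - U a ≤ c * (b - a) := by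
  set M : ℝ → ℝ := fun t => C * t - U t with hM
  have hmono : MonotoneOn M (uIcc a b) := by
    rw [uIcc_of_le hab]
    intro s hs t ht hst
    have := hC s hs t ht hst
    simp only [hM]; linarith
  -- For the monotone `M` the integral of the derivative is at most the increment; jumps and
  -- singular parts of `U` can only decrease it.
  have h1 := hmono.intervalIntegral_deriv_mem_uIcc
  have hMab : 0 ≤ M b - M a := sub_nonneg.2 (hmono (by simp) (by simp) hab)
  rw [uIcc_of_le hMab] at h1
  have h2 := intervalIntegral.integral_mono_ae_restrict hab
    (intervalIntegrable_const (c := C - c)) hmono.intervalIntegrable_deriv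
    ((ae_restrict_iff' measurableSet_Icc).2 ?_)
  · rw [intervalIntegral.integral_const, smul_eq_mul] at h2
    have := h1.2
    simp only [hM] at this h2
    linarith
  · rw [uIcc_of_le hab] at hmono
    filter_upwards [hmono.ae_differentiableWithinAt_of_mem, h, Measure.ae_ne volume a,
      Measure.ae_ne volume b] with t ht hd hta htb htab
    have hI : t ∈ Ioo a b := ⟨lt_of_le_of_ne htab.1 (Ne.symm hta), lt_of_le_of_ne htab.2 htb⟩
    have hdM : HasDerivAt M (deriv M t) t :=
      ((ht htab).differentiableAt (Icc_mem_nhds hI.1 hI.2)).hasDerivAt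
    have hdU : HasDerivAt U (C * 1 - deriv M t) t := by
      have := ((hasDerivAt_id t).const_mul C).sub hdM
      refine this.congr_of_eventuallyEq (Eventually.of_forall fun s => ?_)
      simp [hM]
    have := hd hI _ hdU
    linarith

/-! ### Velocities of the source dynamics -/

section Source

variable {Q : Type*} [Fintype Q]

theorem posProj_nonneg {y ρ : ℝ} (hy : 0 ≤ y) : 0 ≤ posProj y ρ := by
  unfold posProj; split_ifs <;> simp [hy]

theorem posProj_le {y ρ : ℝ} (hy : 0 ≤ y) : posProj y ρ ≤ y := by
  unfold posProj; split_ifs <;> simp [hy]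

/-- Half-spaces are convex, so linear bounds on mixed velocities need checking only for single
selections. -/
theorem apply_le_of_mem_flowVelocities {q ρ v : Q → ℝ} (L : (Q → ℝ) →ₗ[ℝ] ℝ) {c : ℝ}
    (hv : v ∈ flowVelocities q ρ) (h : ∀ m ∈ minDelayPaths q, L (flowField q ρ m) ≤ c) :
    L v ≤ c := by
  refine convexHull_min (t := {w | L w ≤ c}) ?_ (convex_halfSpace_le L.isLinear c) hv
  rintro _ ⟨m, hm, rfl⟩
  exact h m hm

/-- The selected path gains exactly what the others lose, so only differences of weights to `w m`
count. -/
theorem sum_mul_flowField (q ρ w : Q → ℝ) (m : Q) :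
    ∑ P, w P * flowField q ρ m P =
      - ∑ P ∈ open Classical in Finset.univ.erase m, (w P - w m) * posProj (q P - q m) (ρ P) := by
  classical
  rw [← Finset.add_sum_erase _ _ (Finset.mem_univ m)]
  have h1 : flowField q ρ m m = ∑ P' ∈ Finset.univ.erase m, posProj (q P' - q m) (ρ P') := by
    simp only [flowField, if_true]
  have h2 : ∀ P ∈ Finset.univ.erase m, w P * flowField q ρ m P =
      - (w P * posProj (q P - q m) (ρ P)) := by
    intro P hP
    simp [flowField, Finset.ne_of_mem_erase hP]
  rw [Finset.sum_congr rfl h2, h1, Finset.mul_sum, ← Finset.sum_add_distrib,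
    ← Finset.sum_neg_distrib]
  refine Finset.sum_congr (by congr) fun P _ => by ring

/-- The linear functional with coefficients `w`. -/
def weightedSum (w : Q → ℝ) : (Q → ℝ) →ₗ[ℝ] ℝ := ∑ P, w P • LinearMap.proj P

theorem weightedSum_apply (w v : Q → ℝ) : weightedSum w v = ∑ P, w P * v P := by
  simp [weightedSum]

theorem sum_eq_zero_of_mem_flowVelocities {q ρ v : Q → ℝ} (hv : v ∈ flowVelocities q ρ) :
    ∑ P, v P = 0 := by
  have key : ∀ c : ℝ, ∑ P, c * v P ≤ 0 := fun c => by
    have := apply_le_of_mem_flowVelocities (weightedSum fun _ => c) (c := 0) hv fun m _ => by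
      rw [weightedSum_apply, sum_mul_flowField (w := fun _ => c)]; simp
    rwa [weightedSum_apply] at this
  have h1 := key 1
  have h2 := key (-1)
  simp only [one_mul, neg_mul, Finset.sum_neg_distrib] at h1 h2
  linarith

theorem nonneg_of_mem_flowVelocities {q ρ v : Q → ℝ} (hv : v ∈ flowVelocities q ρ) {P : Q}
    (hP : ρ P ≤ 0) : 0 ≤ v P := by
  have := apply_le_of_mem_flowVelocities (-LinearMap.proj P) (c := 0) hv fun m hm => by
    simp only [LinearMap.neg_apply, LinearMap.proj_apply, neg_nonpos]
    unfold flowField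
    split_ifs with h
    · exact Finset.sum_nonneg fun P' _ => posProj_nonneg (sub_nonneg.2 (hm P'))
    · unfold posProj
      split_ifs with h'
      · simp
      -- An empty path escapes the projection only if it ties with the selected one.
      · have : ¬ 0 < q P - q m := fun h0 => h' ⟨h0, hP⟩
        linarith
  simpa using this

theorem abs_le_of_mem_flowVelocities {q ρ v : Q → ℝ} {B : ℝ} (hB : ∀ P, q P ∈ Icc 0 B)
    (hv : v ∈ flowVelocities q ρ) (P : Q) : |v P| ≤ Fintype.card Q * B := by
  have hle : ∀ P m, q P - q m ≤ B := fun P m => by linarith [(hB P).2, (hB m).1]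
  have hB0 : 0 ≤ B := (hB P).1.trans (hB P).2
  have hcard : B ≤ Fintype.card Q * B := by
    have : (1 : ℝ) ≤ Fintype.card Q := by exact_mod_cast Fintype.card_pos_iff.2 ⟨P⟩
    nlinarith
  have key : ∀ m ∈ minDelayPaths q, |flowField q ρ m P| ≤ Fintype.card Q * B := by
    intro m hm
    have hp : ∀ P', posProj (q P' - q m) (ρ P') ∈ Icc 0 B := fun P' =>
      ⟨posProj_nonneg (sub_nonneg.2 (hm P')),
        (posProj_le (sub_nonneg.2 (hm P'))).trans (hle P' m)⟩
    unfold flowField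
    split_ifs with h
    · rw [abs_of_nonneg (Finset.sum_nonneg fun P' _ => (hp P').1)]
      refine (Finset.sum_le_card_nsmul _ _ B fun P' _ => (hp P').2).trans ?_
      rw [nsmul_eq_mul]
      gcongr
      exact Finset.card_le_univ _
    · rw [abs_neg, abs_of_nonneg (hp P).1]
      exact (hp P).2.trans hcard
  rw [abs_le]
  constructor
  · have := apply_le_of_mem_flowVelocities (-LinearMap.proj P) hv fun m hm => by
      simpa using neg_le.1 (abs_le.1 (key m hm)).1
    simp only [LinearMap.neg_apply, LinearMap.proj_apply] at this
    linarith
  · exact apply_le_of_mem_flowVelocities (LinearMap.proj P) hv fun m hm => by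
      simpa using (abs_le.1 (key m hm)).2

/-- Rate of decrease of the delay cost of a source whose used paths are not of minimum delay. -/
def dissipation (q ρ : Q → ℝ) : ℝ :=
  ∑ P, open Classical in if 0 < ρ P then (q P - ⨅ P', q P') ^ 2 else 0

theorem iInf_eq_of_mem_minDelayPaths {q : Q → ℝ} {m : Q} (hm : m ∈ minDelayPaths q) :
    ⨅ P, q P = q m :=
  haveI : Nonempty Q := ⟨m⟩
  le_antisymm (ciInf_le (finite_range q).bddBelow m) (le_ciInf hm)

theorem dissipation_nonneg (q ρ : Q → ℝ) : 0 ≤ dissipation q ρ :=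
  Finset.sum_nonneg fun P _ => by split_ifs <;> positivity

theorem sq_le_dissipation {q ρ : Q → ℝ} {P : Q} (hP : 0 < ρ P) :
    (q P - ⨅ P', q P') ^ 2 ≤ dissipation q ρ := by
  classical
  have := Finset.single_le_sum (f := fun P => if 0 < ρ P then (q P - ⨅ P', q P') ^ 2 else 0)
    (s := Finset.univ) (fun P _ => by split_ifs <;> positivity) (Finset.mem_univ P)
  simp only [hP, if_true] at this
  refine this.trans (le_of_eq ?_)
  unfold dissipation
  refine Finset.sum_congr rfl fun _ _ => by congr

/-- With the delays as weights, a used path contributes the square of its excess delay; an unused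
one contributes a nonnegative amount that is dropped. -/
theorem sum_mul_le_neg_dissipation {q ρ v : Q → ℝ} (hv : v ∈ flowVelocities q ρ) :
    ∑ P, q P * v P ≤ -dissipation q ρ := by
  classical
  rw [← weightedSum_apply]
  refine apply_le_of_mem_flowVelocities _ hv fun m hm => ?_
  rw [weightedSum_apply, sum_mul_flowField, neg_le_neg_iff, dissipation,
    ← Finset.add_sum_erase _ _ (Finset.mem_univ m), iInf_eq_of_mem_minDelayPaths hm]
  simp only [sub_self, ne_eq, OfNat.ofNat_ne_zero, not_false_eq_true, zero_pow, ite_self, zero_add]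
  refine (Finset.sum_le_sum fun P _ => ?_).trans (le_of_eq (Finset.sum_congr (by congr)
    fun _ _ => rfl))
  have h0 := sub_nonneg.2 (hm P)
  split_ifs with h
  · rw [posProj, if_neg (fun h' => h'.2.not_gt h)]; exact (sq _).le
  · exact mul_nonneg h0 (posProj_nonneg h0)

theorem IsWardrop.mul_eq {q ρ : Q → ℝ} (h : IsWardrop q ρ) (hρ : ∀ P, 0 ≤ ρ P) (P : Q) :
    q P * ρ P = (⨅ P', q P') * ρ P := by
  rcases (hρ P).eq_or_lt with h0 | h0
  · simp [← h0]
  · rw [iInf_eq_of_mem_minDelayPaths (m := P) (h P h0)]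

theorem isWardrop_of_sum_le {q ρ : Q → ℝ} (hρ : ∀ P, 0 ≤ ρ P)
    (h : ∑ P, q P * ρ P ≤ (⨅ P', q P') * ∑ P, ρ P) : IsWardrop q ρ := by
  have hle : ∀ P, ⨅ P', q P' ≤ q P := fun P => ciInf_le (finite_range q).bddBelow P
  have hz : ∑ P, (q P - ⨅ P', q P') * ρ P = 0 := by
    refine le_antisymm ?_ (Finset.sum_nonneg fun P _ => mul_nonneg (sub_nonneg.2 (hle P)) (hρ P))
    simp only [sub_mul, Finset.sum_sub_distrib, ← Finset.mul_sum]
    linarith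
  intro P hP P'
  have := (Finset.sum_eq_zero_iff_of_nonneg fun P _ =>
    mul_nonneg (sub_nonneg.2 (hle P)) (hρ P)).1 hz P (Finset.mem_univ P)
  rcases mul_eq_zero.1 this with h0 | h0
  · linarith [hle P']
  · exact absurd h0 hP.ne'

theorem iInf_mul_sum_le {q ρ : Q → ℝ} (hρ : ∀ P, 0 ≤ ρ P) :
    (⨅ P', q P') * ∑ P, ρ P ≤ ∑ P, q P * ρ P := by
  rw [Finset.mul_sum]
  exact Finset.sum_le_sum fun P _ =>
    mul_le_mul_of_nonneg_right (ciInf_le (finite_range q).bddBelow P) (hρ P)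

end Source

namespace InBandNetwork

variable {V Lv Lw ι : Type*} {Path : ι → Type*} (N : InBandNetwork V Lv Lw ι Path)

/-! ### Link rates and path delays -/

section Flows

variable [∀ i, Fintype (Path i)]

theorem isClosed_feasible : IsClosed {r : ∀ i, Path i → ℝ | N.Feasible r} := by
  have h : {r : ∀ i, Path i → ℝ | N.Feasible r} =
      (⋂ i, ⋂ P, {r | 0 ≤ r i P}) ∩ ⋂ i, {r | ∑ P, r i P = N.rate i} := by
    ext r; simp [Feasible]
  rw [h]
  refine IsClosed.inter (isClosed_iInter fun i => isClosed_iInter fun P => ?_)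
    (isClosed_iInter fun i => ?_)
  · exact isClosed_le continuous_const (by fun_prop)
  · exact isClosed_eq (by fun_prop) continuous_const

theorem Feasible.mem_Icc {r : ∀ i, Path i → ℝ} (hr : N.Feasible r) (i : ι) (P : Path i) :
    r i P ∈ Icc 0 (N.rate i) :=
  ⟨hr.1 i P, by
    rw [← hr.2 i]
    exact Finset.single_le_sum (fun P _ => hr.1 i P) (Finset.mem_univ P)⟩

theorem isCompact_feasible : IsCompact {r : ∀ i, Path i → ℝ | N.Feasible r} := by
  refine (isCompact_univ_pi fun i => isCompact_univ_pi fun _ : Path i =>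
    isCompact_Icc (a := (0 : ℝ)) (b := N.rate i)).of_isClosed_subset N.isClosed_feasible ?_
  intro r hr i _ P _
  exact hr.mem_Icc N i P

variable [Fintype ι]

theorem continuous_linkRate (l : Lv ⊕ Lw) :
    Continuous fun r : ∀ i, Path i → ℝ => N.linkRate r l := by
  unfold linkRate
  refine continuous_finsetSum _ fun i _ => continuous_finsetSum _ fun P _ => ?_
  split_ifs
  · fun_prop
  · fun_prop

theorem linkRate_nonneg {r : ∀ i, Path i → ℝ} (hr : ∀ i P, 0 ≤ r i P) (l : Lv ⊕ Lw) :
    0 ≤ N.linkRate r l :=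
  Finset.sum_nonneg fun i _ => Finset.sum_nonneg fun P _ => by split_ifs <;> simp [hr]

theorem Feasible.linkRate_le {r : ∀ i, Path i → ℝ} (hr : N.Feasible r) (l : Lv ⊕ Lw) :
    N.linkRate r l ≤ ∑ i, N.rate i := by
  refine Finset.sum_le_sum fun i _ => ?_
  rw [← hr.2 i]
  exact Finset.sum_le_sum fun P _ => by split_ifs <;> simp [hr.1]

theorem hasDerivAt_linkRate {r : ℝ → ∀ i, Path i → ℝ} {v : ∀ i, Path i → ℝ} {t : ℝ}
    (h : HasDerivAt r v t) (l : Lv ⊕ Lw) :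
    HasDerivAt (fun τ => N.linkRate (r τ) l) (N.linkRate v l) t := by
  unfold linkRate
  refine HasDerivAt.fun_sum fun i _ => HasDerivAt.fun_sum fun P _ => ?_
  split_ifs
  · exact hasDerivAt_pi.1 (hasDerivAt_pi.1 h i) P
  · exact hasDerivAt_const _ _

theorem linkRate_sub (r r' : ∀ i, Path i → ℝ) (l : Lv ⊕ Lw) :
    N.linkRate (r - r') l = N.linkRate r l - N.linkRate r' l := by
  simp only [linkRate, ← Finset.sum_sub_distrib]
  refine Finset.sum_congr rfl fun i _ => Finset.sum_congr rfl fun P _ => ?_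
  split_ifs <;> simp

theorem abs_linkRate_le (v : ∀ i, Path i → ℝ) (l : Lv ⊕ Lw) :
    |N.linkRate v l| ≤ ∑ i, ∑ P, |v i P| := by
  refine (Finset.abs_sum_le_sum_abs _ _).trans (Finset.sum_le_sum fun i _ =>
    (Finset.abs_sum_le_sum_abs _ _).trans (Finset.sum_le_sum fun P _ => ?_))
  split_ifs <;> simp

/-- Double counting: paying per link equals paying per path. -/
theorem sum_mul_linkRate [Fintype Lv] [Fintype Lw] (p : Lv ⊕ Lw → ℝ) (v : ∀ i, Path i → ℝ) :
    ∑ l, p l * N.linkRate v l = ∑ i, ∑ P, N.pathDelay p i P * v i P := by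
  classical
  simp only [linkRate, Finset.mul_sum]
  rw [Finset.sum_comm]
  refine Finset.sum_congr rfl fun i _ => ?_
  rw [Finset.sum_comm]
  refine Finset.sum_congr rfl fun P _ => ?_
  rw [pathDelay, Finset.sum_mul]
  simp [mul_ite, Finset.sum_ite_mem]

/-- Variational inequality: at frozen prices a Wardrop flow attains the cheapest possible cost of
every source. -/
theorem sum_mul_linkRate_le_of_isWardrop [Fintype Lv] [Fintype Lw] {p : Lv ⊕ Lw → ℝ}
    {r r' : ∀ i, Path i → ℝ} (hr : N.Feasible r) (hr' : N.Feasible r')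
    (hw : ∀ i, IsWardrop (N.pathDelay p i) (r i)) :
    ∑ l, p l * N.linkRate r l ≤ ∑ l, p l * N.linkRate r' l := by
  rw [sum_mul_linkRate, sum_mul_linkRate]
  refine Finset.sum_le_sum fun i _ => ?_
  calc ∑ P, N.pathDelay p i P * r i P
      = (⨅ P', N.pathDelay p i P') * ∑ P, r i P := by
        rw [Finset.mul_sum]
        exact Finset.sum_congr rfl fun P _ => (hw i).mul_eq (hr.1 i) P
    _ = (⨅ P', N.pathDelay p i P') * ∑ P, r' i P := by rw [hr.2 i, hr'.2 i]
    _ ≤ _ := iInf_mul_sum_le (hr'.1 i)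

/-- The Wardrop property is inherited by feasible flows with the same link rates. -/
theorem isWardrop_of_linkRate_eq [Fintype Lv] [Fintype Lw] {p : Lv ⊕ Lw → ℝ}
    {r r' : ∀ i, Path i → ℝ} (hr : N.Feasible r) (hr' : N.Feasible r')
    (hw : ∀ i, IsWardrop (N.pathDelay p i) (r i)) (h : N.linkRate r' = N.linkRate r) (i : ι) :
    IsWardrop (N.pathDelay p i) (r' i) := by
  refine isWardrop_of_sum_le (hr'.1 i) ?_
  have hsum : ∑ i, ∑ P, N.pathDelay p i P * r' i P =
      ∑ i, (⨅ P', N.pathDelay p i P') * ∑ P, r' i P := by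
    rw [← sum_mul_linkRate, h, sum_mul_linkRate]
    refine Finset.sum_congr rfl fun i _ => ?_
    rw [hr'.2 i, ← hr.2 i, Finset.mul_sum]
    exact Finset.sum_congr rfl fun P _ => (hw i).mul_eq (hr.1 i) P
  -- The total cost equals the sum of the lower bounds of the sources, so each bound is attained.
  exact ((Finset.sum_eq_sum_iff_of_le fun i _ => iInf_mul_sum_le (hr'.1 i)).1 hsum.symm i
    (Finset.mem_univ i)).ge

/-- The sum of the two variational inequalities is a nonpositive sum of nonnegative products, so
each product vanishes. -/
theorem linkRate_eq_of_isWardrop [Fintype Lv] [Fintype Lw] {G : Lv ⊕ Lw → ℝ → ℝ}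
    (hG : ∀ l, StrictMonoOn (G l) (Ici 0)) {p p' : Lv ⊕ Lw → ℝ} {r r' : ∀ i, Path i → ℝ}
    (hr : N.Feasible r) (hr' : N.Feasible r')
    (hw : ∀ i, IsWardrop (N.pathDelay p i) (r i)) (hw' : ∀ i, IsWardrop (N.pathDelay p' i) (r' i))
    (hp : ∀ l, PriceBetween (G l) (N.linkRate r l) (p l))
    (hp' : ∀ l, PriceBetween (G l) (N.linkRate r' l) (p' l)) : N.linkRate r' = N.linkRate r := by
  have h1 := N.sum_mul_linkRate_le_of_isWardrop hr hr' hw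
  have h2 := N.sum_mul_linkRate_le_of_isWardrop hr' hr hw'
  have hnn : ∀ l, 0 ≤ (p' l - p l) * (N.linkRate r' l - N.linkRate r l) := fun l =>
    (hp' l).mul_nonneg (hG l).monotoneOn (hp l) (N.linkRate_nonneg hr'.1 l)
      (N.linkRate_nonneg hr.1 l)
  have hz : ∑ l, (p' l - p l) * (N.linkRate r' l - N.linkRate r l) = 0 := by
    refine le_antisymm ?_ (Finset.sum_nonneg fun l _ => hnn l)
    simp only [sub_mul, mul_sub, Finset.sum_sub_distrib]
    linarith
  funext l
  exact (hp' l).eq_of_mul_nonpos (hG l) (hp l) (N.linkRate_nonneg hr'.1 l)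
    (N.linkRate_nonneg hr.1 l)
    ((Finset.sum_eq_zero_iff_of_nonneg fun l _ => hnn l).1 hz l (Finset.mem_univ l)).le

end Flows

/-! ### Link prices -/

/-- Price of a link as a function of its rate, at fractions `ξ` of compromised nodes. -/
def price (ξ : Lw → ℝ) : Lv ⊕ Lw → ℝ → ℝ
  | Sum.inl l => N.validPrice l
  | Sum.inr l => fun s => N.wormPrice l s (ξ l)

theorem priceSet_eq (z : ℝ) (ξ : Lw → ℝ) (l : Lv ⊕ Lw) :
    N.priceSet z ξ l = krasovskii (N.price ξ l) (Ici 0) z := by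
  cases l <;> rfl

theorem alarm_nonneg (l : Lv ⊕ Lw) (s p : ℝ) : 0 ≤ N.alarm l s p := by
  unfold alarm; split_ifs <;> simp

/-- Increments of the price dominate those of the delay. -/
theorem exists_delay_sub_le_price_sub [Fintype V] (hN : N.Standing) {ξ : Lw → ℝ}
    (hξ : ∀ l, ξ l ∈ Icc (0 : ℝ) 1) (l : Lv ⊕ Lw) {s s' : ℝ} (hs : 0 ≤ s) (hss : s ≤ s') :
    Sum.elim (fun _ => 1) (fun l => N.β l (ξ l)) l * (N.delay l s' - N.delay l s) ≤
      N.price ξ l s' - N.price ξ l s := by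
  have hs' : s' ∈ Ici (0 : ℝ) := hs.trans hss
  cases l with
  | inl l =>
    have := mul_le_mul_of_nonneg_left (hN.alarm_mono_valid l hs hs' hss) hN.K_nonneg
    simp only [price, validPrice, Sum.elim_inl] at this ⊢
    linarith
  | inr l =>
    have := mul_le_mul_of_nonneg_left (hN.alarm_mono_worm l _ (hξ l) hs hs' hss) hN.K_nonneg
    simp only [price, wormPrice, Sum.elim_inr] at this ⊢
    linarith

theorem strictMonoOn_price [Fintype V] (hN : N.Standing) {ξ : Lw → ℝ}
    (hξ : ∀ l, ξ l ∈ Icc (0 : ℝ) 1) (l : Lv ⊕ Lw) : StrictMonoOn (N.price ξ l) (Ici 0) := by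
  intro s hs s' hs' hss
  have h1 := N.exists_delay_sub_le_price_sub hN hξ l hs hss.le
  have h2 := hN.delay_strictMono l hs hs' hss
  have h3 : 0 < Sum.elim (fun _ => (1 : ℝ)) (fun l => N.β l (ξ l)) l := by
    cases l with
    | inl l => simp
    | inr l => exact hN.β_pos l _ (hξ l)
  have := mul_pos h3 (sub_pos.2 h2)
  linarith

theorem price_nonneg [Fintype V] (hN : N.Standing) {ξ : Lw → ℝ}
    (hξ : ∀ l, ξ l ∈ Icc (0 : ℝ) 1) (l : Lv ⊕ Lw) {s : ℝ} (hs : 0 ≤ s) : 0 ≤ N.price ξ l s := by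
  have hd := hN.delay_nonneg l s hs
  cases l with
  | inl l => exact add_nonneg hd (mul_nonneg hN.K_nonneg (N.alarm_nonneg _ _ _))
  | inr l =>
    exact add_nonneg (mul_nonneg (hN.β_pos l _ (hξ l)).le hd)
      (mul_nonneg hN.K_nonneg (N.alarm_nonneg _ _ _))

theorem price_le_price [Fintype V] (hN : N.Standing) {ξ η : Lw → ℝ}
    (hη : ∀ l, η l ∈ Icc (0 : ℝ) 1)
    (h : ∀ l, N.β l (η l) ≤ N.β l (ξ l)) (l : Lv ⊕ Lw) {s : ℝ} (hs : 0 ≤ s) :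
    N.price η l s ≤ N.price ξ l s := by
  cases l with
  | inl l => exact le_rfl
  | inr l =>
    have hd := hN.delay_nonneg (Sum.inr l) s hs
    have h1 := mul_le_mul_of_nonneg_right (h l) hd
    have h0 := mul_nonneg (hN.β_pos l _ (hη l)).le hd
    exact add_le_add h1 (mul_le_mul_of_nonneg_left
      (hN.alarm_mono_delay l s hs h0 (h0.trans h1) h1) hN.K_nonneg)

/-- The slice `u ↦ (u, ξ n l)` is an isometry into the joint domain, so limits of prices regularized
in the rate alone land in the joint regularization. -/
theorem mem_steadyPriceSet_of_tendsto {z : ℕ → ℝ} {ξ : ℕ → Lw → ℝ} {p : ℕ → ℝ} {a q : ℝ}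
    {η : Lw → ℝ} (l : Lv ⊕ Lw) (hξ : ∀ n l, ξ n l ∈ Icc (0 : ℝ) 1)
    (hz : Tendsto z atTop (𝓝 a)) (hξt : Tendsto ξ atTop (𝓝 η)) (hp : Tendsto p atTop (𝓝 q))
    (h : ∀ n, p n ∈ N.priceSet (z n) (ξ n) l) : q ∈ N.steadyPriceSet a η l := by
  cases l with
  | inl l =>
    exact mem_krasovskii_of_tendsto (j := fun _ u => u) (fun _ _ _ => le_rfl)
      (fun _ _ hu => hu) hz hp h
  | inr l =>
    refine mem_krasovskii_of_tendsto (g := fun a : ℝ × ℝ => N.wormPrice l a.1 a.2)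
      (j := fun n u => (u, ξ n l)) (fun n u v => ?_) (fun n u hu => ⟨hu, hξ n l⟩) ?_ hp h
    · simp [Prod.dist_eq]
    · exact hz.prodMk_nhds ((continuous_apply l).tendsto η |>.comp hξt)

/-- Between `s` and `z` there is a rate `u` at which the price is continuous in the fraction.
Monotonicity in the rate compares nearby prices with the price at `u`, and continuity there moves
the fraction to `η l`. -/
theorem priceBetween_of_nonSwitching [Fintype V] (hN : N.Standing) {η : Lw → ℝ}
    (hη : ∀ l, η l ∈ Icc (0 : ℝ) 1) (hns : N.NonSwitching η) {l : Lv ⊕ Lw} {z p : ℝ}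
    (hz : 0 ≤ z) (hp : p ∈ N.steadyPriceSet z η l) : PriceBetween (N.price η l) z p := by
  have hmono : ∀ {ξ : Lw → ℝ}, (∀ l, ξ l ∈ Icc (0 : ℝ) 1) → ∀ l,
    MonotoneOn (N.price ξ l) (Ici 0) := fun hξ l => (N.strictMonoOn_price hN hξ l).monotoneOn
  cases l with
  | inl l => exact PriceBetween.of_mem_krasovskii (hmono hη (Sum.inl l)) hp
  | inr l =>
    have hworm : ∀ x ∈ Icc (0 : ℝ) 1, MonotoneOn (fun s => N.wormPrice l s x) (Ici 0) :=
      fun x hx => hmono (ξ := fun _ => x) (fun _ => hx) (Sum.inr l)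
    have hdense : ∀ a b : ℝ, 0 ≤ a → a < b → ∃ s ∈ Ioo a b,
        ContinuousWithinAt (fun ξ => N.wormPrice l s ξ) (Icc 0 1) (η l) := by
      intro a b ha hab
      by_contra! hcon
      refine (Cardinal.Real.Ioo_countable_iff.not.2 hab.not_ge) ((hns l).mono fun s hs => ?_)
      exact ⟨ha.trans hs.1.le, hcon s hs⟩
    have hloc : ∀ s, ContinuousWithinAt (fun ξ => N.wormPrice l s ξ) (Icc 0 1) (η l) →
        ∀ ε > 0, ∃ δ > 0, ∀ ξ ∈ Icc (0 : ℝ) 1, dist ξ (η l) < δ →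
          |N.wormPrice l s ξ - N.wormPrice l s (η l)| < ε := by
      intro s hs ε hε
      obtain ⟨δ, hδ, h⟩ := Metric.continuousWithinAt_iff.1 hs ε hε
      exact ⟨δ, hδ, fun ξ hξ hd => by simpa [Real.dist_eq] using h hξ hd⟩
    constructor
    · intro s hs hsz
      obtain ⟨u, ⟨hsu, huz⟩, hu⟩ := hdense s z hs hsz
      refine (hworm _ (hη l) hs (hs.trans hsu.le) hsu.le).trans
        (le_of_forall_pos_le_add fun ε hε => ?_)
      obtain ⟨δ, hδ, h⟩ := hloc u hu ε hε
      -- The radius keeps the fraction within `δ` of `η l` and the rate above `u`.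
      have := ge_of_mem_krasovskii (c := N.wormPrice l u (η l) - ε) hp
        (lt_min hδ (sub_pos.2 huz)) fun b hb hbz => ?_
      · linarith
      · rw [Prod.dist_eq, max_lt_iff, lt_min_iff, lt_min_iff, Real.dist_eq b.1] at hbz
        have h1 := h b.2 hb.2 hbz.2.1
        have h2 := hworm b.2 hb.2 (hs.trans hsu.le) hb.1
          (by linarith [(abs_lt.1 hbz.1.2).1] : u ≤ b.1)
        simp only at h2
        linarith [(abs_lt.1 h1).1]
    · intro s hzs
      obtain ⟨u, ⟨hzu, hus⟩, hu⟩ := hdense z s hz hzs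
      have hu0 : 0 ≤ u := hz.trans hzu.le
      refine le_trans (le_of_forall_pos_le_add fun ε hε => ?_)
        (hworm _ (hη l) hu0 (hu0.trans hus.le) hus.le)
      obtain ⟨δ, hδ, h⟩ := hloc u hu ε hε
      refine le_of_mem_krasovskii hp (lt_min hδ (sub_pos.2 hzu)) fun b hb hbz => ?_
      rw [Prod.dist_eq, max_lt_iff, lt_min_iff, lt_min_iff, Real.dist_eq b.1] at hbz
      have h1 := h b.2 hb.2 hbz.2.1
      have h2 := hworm b.2 hb.2 hb.1 hu0
          (by linarith [(abs_lt.1 hbz.1.2).2] : b.1 ≤ u)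
      simp only at h2
      linarith [(abs_lt.1 h1).2]

end InBandNetwork

/-! ### Two facts about scalar trajectories -/

/-- After the last time in `[0, T]` with `f ≥ 0` the function is negative, hence nondecreasing, and
cannot have become negative. -/
theorem nonneg_of_ae_deriv_nonneg {f : ℝ → ℝ}
    (hf : ∀ T, 0 ≤ T → AbsolutelyContinuousOnInterval f 0 T) (h0 : 0 ≤ f 0)
    (h : ∀ᵐ t, 0 ≤ t → f t ≤ 0 → 0 ≤ deriv f t) {T : ℝ} (hT : 0 ≤ T) : 0 ≤ f T := by
  by_contra! hneg
  have hcont : ContinuousOn f (Icc 0 T) := by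
    have := (hf T hT).continuousOn
    rwa [uIcc_of_le hT] at this
  have hcomp : IsCompact (Icc 0 T ∩ f ⁻¹' Ici 0) :=
    isCompact_Icc.of_isClosed_subset (hcont.preimage_isClosed_of_isClosed isClosed_Icc isClosed_Ici)
      inter_subset_left
  obtain ⟨s, ⟨hs, hfs⟩, hmax⟩ := hcomp.exists_isGreatest ⟨0, ⟨le_rfl, hT⟩, h0⟩
  have hac : AbsolutelyContinuousOnInterval f s T := (hf T hT).mono (by
    rw [uIcc_of_le hT, uIcc_of_le hs.2]
    exact Icc_subset_Icc_left hs.1)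
  have := hac.le_sub_of_le_deriv (c := 0) hs.2 (by
    filter_upwards [h] with t ht hst
    refine ht (hs.1.trans hst.1.le) (le_of_not_gt fun hpos => ?_)
    exact hst.1.not_ge (hmax ⟨⟨hs.1.trans hst.1.le, hst.2⟩, hpos.le⟩))
  have hfs' : 0 ≤ f s := hfs
  linarith

/-- A monotone bounded trajectory of an autonomous equation with continuous nonnegative velocity
converges to a rest point. -/
theorem exists_tendsto_of_hasDerivWithinAt_nonneg {x : ℝ → ℝ} {F : ℝ → ℝ} {a b : ℝ}
    (hF : ContinuousOn F (Icc a b)) (hF0 : ∀ u ∈ Icc a b, 0 ≤ F u)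
    (hx : ∀ t, 0 ≤ t → x t ∈ Icc a b)
    (hd : ∀ t, 0 ≤ t → HasDerivWithinAt x (F (x t)) (Ici 0) t) :
    ∃ y ∈ Icc a b, F y = 0 ∧ Tendsto x atTop (𝓝 y) := by
  have hcont : ContinuousOn x (Ici 0) := fun t ht => (hd t ht).continuousWithinAt
  have hder : ∀ t ∈ interior (Ici (0 : ℝ)), HasDerivAt x (F (x t)) t := fun t ht => by
    rw [interior_Ici] at ht
    exact (hd t ht.le).hasDerivAt (Ici_mem_nhds ht)
  have hmono : MonotoneOn x (Ici 0) :=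
    monotoneOn_of_deriv_nonneg (convex_Ici 0) hcont
      (fun t ht => (hder t ht).differentiableAt.differentiableWithinAt) fun t ht => by
        rw [(hder t ht).deriv]
        exact hF0 _ (hx t (interior_subset ht))
  have hm : Monotone fun t => x (max t 0) := fun s t hst =>
    hmono (mem_Ici.2 (le_max_right _ _)) (mem_Ici.2 (le_max_right _ _)) (max_le_max_right 0 hst)
  have hlim : Tendsto (fun t => x (max t 0)) atTop (𝓝 (⨆ t, x (max t 0))) :=
    tendsto_atTop_ciSup hm ⟨b, by rintro _ ⟨t, rfl⟩; exact (hx _ (le_max_right _ _)).2⟩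
  have hlim' : Tendsto x atTop (𝓝 (⨆ t, x (max t 0))) := by
    refine hlim.congr' ?_
    filter_upwards [eventually_ge_atTop 0] with t ht
    rw [max_eq_left ht]
  set y := ⨆ t, x (max t 0)
  have hev : ∀ᶠ t in atTop, x t ∈ Icc a b := (eventually_ge_atTop 0).mono hx
  have hy : y ∈ Icc a b := isClosed_Icc.mem_of_tendsto hlim' hev
  refine ⟨y, hy, ?_, hlim'⟩
  by_contra hne
  have hpos : 0 < F y := lt_of_le_of_ne (hF0 y hy) (Ne.symm hne)
  have hFx : Tendsto (fun t => F (x t)) atTop (𝓝 (F y)) :=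
    (hF y hy).tendsto.comp (tendsto_nhdsWithin_iff.2 ⟨hlim', hev⟩)
  obtain ⟨T, hT⟩ := eventually_atTop.1 (hFx.eventually (lt_mem_nhds (half_lt_self hpos)))
  set T' := max T 0
  have hT'0 : (0 : ℝ) ≤ T' := le_max_right _ _
  have hTT' : T ≤ T' := le_max_left _ _
  have hgrow : ∀ t, T' ≤ t → F y / 2 * (t - T') ≤ x t - x T' := fun t ht =>
    (convex_Ici T').mul_sub_le_image_sub_of_le_deriv
      (hcont.mono (Ici_subset_Ici.2 hT'0))
      (fun s hs => (hder s (interior_mono (Ici_subset_Ici.2 hT'0) hs)).differentiableAt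
        |>.differentiableWithinAt)
      (fun s hs => by
        rw [(hder s (interior_mono (Ici_subset_Ici.2 hT'0) hs)).deriv]
        exact (hT s (hTT'.trans (interior_subset hs))).le)
      T' self_mem_Ici t ht ht
  have hab : a ≤ b := hy.1.trans hy.2
  -- After this time, growth at speed `F y / 2` exceeds the length of `[a, b]` by one.
  have h1 := hgrow (T' + 2 * (b - a + 1) / F y) (by
    have : 0 ≤ 2 * (b - a + 1) / F y := div_nonneg (by linarith) hpos.le
    linarith)
  have h2 : F y / 2 * (T' + 2 * (b - a + 1) / F y - T') = b - a + 1 := by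
    field_simp; ring
  have h3 := hx (T' + 2 * (b - a + 1) / F y) (by
    have : 0 ≤ 2 * (b - a + 1) / F y := div_nonneg (by linarith) hpos.le
    linarith)
  have h4 := hx T' hT'0
  linarith [h3.2, h4.1]

namespace InBandNetwork

variable {V Lv Lw ι : Type*} {Path : ι → Type*} {N : InBandNetwork V Lv Lw ι Path}

namespace IsSolution

variable [Fintype ι] [∀ i, Fintype (Path i)]
  {r : ℝ → ∀ i, Path i → ℝ} {x : ℝ → Lw → ℝ}

/-! ### The fractions of compromised nodes and the limits of the prices -/

theorem exists_tendsto_fraction [Fintype V] (hN : N.Standing) (hsol : N.IsSolution r x) :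
    ∃ xs : Lw → ℝ, (∀ l, xs l ∈ Icc (0 : ℝ) 1 ∧ N.compromiseRate l (xs l) = 0) ∧
      Tendsto x atTop (𝓝 xs) := by
  have h : ∀ l, ∃ y ∈ Icc (0 : ℝ) 1, N.compromiseRate l y = 0 ∧
      Tendsto (fun t => x t l) atTop (𝓝 y) := fun l => by
    refine exists_tendsto_of_hasDerivWithinAt_nonneg (F := N.compromiseRate l) ?_
      (fun u _ => le_max_right _ _) (fun t ht => hsol.fraction t ht l)
      fun t ht => hsol.compromise t ht l
    unfold compromiseRate
    have := (hN.β_contDiff l).continuousOn_derivWithin (uniqueDiffOn_Icc zero_lt_one) le_rfl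
    exact (this.neg.sub continuousOn_const).sup continuousOn_const
  choose xs h1 h2 h3 using h
  exact ⟨xs, fun l => ⟨h1 l, h2 l⟩, tendsto_pi_nhds.2 h3⟩

/-- The fraction moves only where `β'` is below `-cA`, hence negative. -/
theorem antitoneOn_β [Fintype V] (hN : N.Standing) (hsol : N.IsSolution r x) (l : Lw) :
    AntitoneOn (fun t => N.β l (x t l)) (Ici 0) := by
  have hd : ∀ t ∈ Ici (0 : ℝ), HasDerivWithinAt (fun t => N.β l (x t l))
      (derivWithin (N.β l) (Icc 0 1) (x t l) * N.compromiseRate l (x t l)) (Ici 0) t :=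
    fun t ht => HasDerivWithinAt.comp t
      (((hN.β_contDiff l).differentiableOn one_ne_zero) _
        (hsol.fraction t ht l)).hasDerivWithinAt (hsol.compromise t ht l)
      fun s hs => hsol.fraction s hs l
  have hd' : ∀ t ∈ interior (Ici (0 : ℝ)), HasDerivAt (fun t => N.β l (x t l))
      (derivWithin (N.β l) (Icc 0 1) (x t l) * N.compromiseRate l (x t l)) t := fun t ht => by
    refine (hd t (interior_subset ht)).hasDerivAt ?_
    rw [interior_Ici] at ht
    exact Ici_mem_nhds ht
  refine antitoneOn_of_deriv_nonpos (convex_Ici 0) (fun t ht => (hd t ht).continuousWithinAt)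
    (fun t ht => (hd' t ht).differentiableAt.differentiableWithinAt) fun t ht => ?_
  rw [(hd' t ht).deriv, compromiseRate]
  rcases le_total (derivWithin (N.β l) (Icc 0 1) (x t l)) 0 with h | h
  · exact mul_nonpos_of_nonpos_of_nonneg h (le_max_right _ _)
  · rw [max_eq_right (by linarith [hN.cA_pos])]; simp

theorem price_antitone [Fintype V] (hN : N.Standing) (hsol : N.IsSolution r x) (l : Lv ⊕ Lw) {s : ℝ}
    (hs : 0 ≤ s) : AntitoneOn (fun t => N.price (x t) l s) (Ici 0) := fun _ ht t' ht' htt =>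
  N.price_le_price hN (hsol.fraction t' ht') (fun l => hsol.antitoneOn_β hN l ht ht' htt) l hs

theorem exists_limit_price [Fintype V] (hN : N.Standing) (hsol : N.IsSolution r x) {xs : Lw → ℝ}
    (hxs : ∀ l, xs l ∈ Icc (0 : ℝ) 1) (hx : Tendsto x atTop (𝓝 xs)) :
    ∃ Y : Lv ⊕ Lw → ℝ → ℝ,
      (∀ l s, 0 ≤ s → Tendsto (fun t => N.price (x t) l s) atTop (𝓝 (Y l s))) ∧
      (∀ l s t, 0 ≤ s → 0 ≤ t → Y l s ≤ N.price (x t) l s) ∧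
      ∀ l, StrictMonoOn (Y l) (Ici 0) := by
  have hlim : ∀ l s, 0 ≤ s →
      Tendsto (fun t => N.price (x t) l s) atTop (𝓝 (⨅ t, N.price (x (max t 0)) l s)) := by
    intro l s hs
    have hm : Antitone fun t => N.price (x (max t 0)) l s := fun t t' hst =>
      hsol.price_antitone hN l hs (mem_Ici.2 (le_max_right _ _))
        (mem_Ici.2 (le_max_right _ _)) (max_le_max_right 0 hst)
    refine (tendsto_atTop_ciInf hm ⟨0, ?_⟩).congr' ?_
    · rintro _ ⟨t, rfl⟩
      exact N.price_nonneg hN (hsol.fraction _ (le_max_right _ _)) l hs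
    · filter_upwards [eventually_ge_atTop 0] with t ht
      rw [max_eq_left ht]
  refine ⟨fun l s => ⨅ t, N.price (x (max t 0)) l s, hlim, fun l s t hs ht => ?_, fun l => ?_⟩
  · refine le_of_tendsto (hlim l s hs) ?_
    filter_upwards [eventually_ge_atTop t] with t' htt'
    exact hsol.price_antitone hN l hs ht (ht.trans htt') htt'
  · intro s hs s' hs' hss
    -- A limit of strict inequalities is only weak; the gap survives because it dominates a delay
    -- increment times a factor with positive limit.
    have hd := sub_pos.2 (hN.delay_strictMono l hs hs' hss)
    have hfac : Tendsto (fun t => Sum.elim (fun _ => (1 : ℝ)) (fun l => N.β l (x t l)) l) atTop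
        (𝓝 (Sum.elim (fun _ => (1 : ℝ)) (fun l => N.β l (xs l)) l)) := by
      cases l with
      | inl l => exact tendsto_const_nhds
      | inr l =>
        exact ((hN.β_contDiff l).continuousOn _ (hxs l)).tendsto.comp (tendsto_nhdsWithin_iff.2
          ⟨tendsto_pi_nhds.1 hx l, (eventually_ge_atTop 0).mono fun t ht => hsol.fraction t ht l⟩)
    have hpos : 0 < Sum.elim (fun _ => (1 : ℝ)) (fun l => N.β l (xs l)) l := by
      cases l with
      | inl l => exact one_pos
      | inr l => exact hN.β_pos l _ (hxs l)
    have := le_of_tendsto_of_tendsto (hfac.mul_const _) ((hlim l s' hs').sub (hlim l s hs))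
      ((eventually_ge_atTop 0).mono fun t ht =>
        N.exists_delay_sub_le_price_sub hN (hsol.fraction t ht) l hs hss.le)
    have := mul_pos hpos hd
    linarith

/-! ### Feasibility and Lipschitz continuity of the flows -/

theorem ae_flow (hsol : N.IsSolution r x) : ∀ᵐ t : ℝ, 0 ≤ t → ∃ p : Lv ⊕ Lw → ℝ,
    (∀ l, p l ∈ N.priceSet (N.linkRate (r t) l) (x t) l) ∧
    ∃ v : ∀ i, Path i → ℝ, HasDerivAt r v t ∧
      ∀ i, v i ∈ flowVelocities (N.pathDelay p i) (r t i) :=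
  (ae_restrict_iff' measurableSet_Ici).1 hsol.flow

theorem absCont_clm (hsol : N.IsSolution r x) (L : (∀ i, Path i → ℝ) →L[ℝ] ℝ) {s t : ℝ}
    (hs : 0 ≤ s) (ht : 0 ≤ t) : AbsolutelyContinuousOnInterval (fun τ => L (r τ)) s t := by
  have h : uIcc s t ⊆ uIcc 0 (max s t) := by
    rw [uIcc_of_le (hs.trans (le_max_left _ _))]
    exact fun τ hτ => ⟨(le_inf hs ht).trans hτ.1, hτ.2⟩
  exact ((hsol.absCont _ (hs.trans (le_max_left _ _))).lipschitzWith_comp L.lipschitz).mono h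

/-- The rate of a path as a linear functional of the flow allocation. -/
def pathRate (i : ι) (P : Path i) : (∀ i, Path i → ℝ) →L[ℝ] ℝ :=
  (ContinuousLinearMap.proj (R := ℝ) (φ := fun _ : Path i => ℝ) P).comp
    (ContinuousLinearMap.proj (R := ℝ) (φ := fun i => Path i → ℝ) i)

/-- The projection keeps rates from crossing zero, and velocities sum to zero for each source. -/
theorem feasible (hsol : N.IsSolution r x) {t : ℝ} (ht : 0 ≤ t) : N.Feasible (r t) := by
  constructor
  · intro i P
    refine nonneg_of_ae_deriv_nonneg (f := fun τ => pathRate i P (r τ))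
      (fun T hT => hsol.absCont_clm _ le_rfl hT) (hsol.init.1 i P) ?_ ht
    filter_upwards [hsol.ae_flow] with τ hτ hτ0 hneg
    obtain ⟨p, -, v, hv, hvel⟩ := hτ hτ0
    have hd : HasDerivAt (fun τ => pathRate i P (r τ)) (pathRate i P v) τ :=
      (pathRate i P).hasFDerivAt.comp_hasDerivAt τ hv
    rw [hd.deriv]
    exact nonneg_of_mem_flowVelocities (hvel i) hneg
  · intro i
    set L : (∀ i, Path i → ℝ) →L[ℝ] ℝ := ∑ P, pathRate i P with hL
    have hLa : ∀ w, L w = ∑ P, w i P := fun w => by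
      simp [hL, pathRate]
    have hac := hsol.absCont_clm L le_rfl ht
    have hder : ∀ᵐ τ, τ ∈ Ioc 0 t → deriv (fun τ => L (r τ)) τ = 0 := by
      filter_upwards [hsol.ae_flow] with τ hτ hτ0
      obtain ⟨p, -, v, hv, hvel⟩ := hτ hτ0.1.le
      have hd : HasDerivAt (fun τ => L (r τ)) (L v) τ := L.hasFDerivAt.comp_hasDerivAt τ hv
      rw [hd.deriv, hLa]
      exact sum_eq_zero_of_mem_flowVelocities (hvel i)
    have h1 := hac.sub_le_of_deriv_le (c := 0) ht (hder.mono fun τ h hτ => (h hτ).le)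
    have h2 := hac.le_sub_of_le_deriv (c := 0) ht (hder.mono fun τ h hτ => (h hτ).ge)
    have h0 := hsol.init.2 i
    rw [hLa, hLa] at h1 h2
    linarith

end IsSolution
end InBandNetwork

/-! ### The potential of a system of link prices -/

section Potential

variable {E : Type*} [Fintype E]

/-- Beckmann potential of the link prices `G` at link rates `z`. -/
def potential (G : E → ℝ → ℝ) (z : E → ℝ) : ℝ := ∑ l, ∫ s in (0 : ℝ)..z l, G l s

theorem potential_nonneg {G : E → ℝ → ℝ} (hG : ∀ l s, 0 ≤ s → 0 ≤ G l s) {z : E → ℝ}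
    (hz : ∀ l, 0 ≤ z l) : 0 ≤ potential G z :=
  Finset.sum_nonneg fun l _ => intervalIntegral.integral_nonneg (hz l) fun s hs => hG l s hs.1

theorem potential_mono {G H : E → ℝ → ℝ} (hG : ∀ l, MonotoneOn (G l) (Ici 0))
    (hH : ∀ l, MonotoneOn (H l) (Ici 0)) (h : ∀ l s, 0 ≤ s → G l s ≤ H l s) {z : E → ℝ}
    (hz : ∀ l, 0 ≤ z l) : potential G z ≤ potential H z :=
  Finset.sum_le_sum fun l _ => intervalIntegral.integral_mono_on (hz l)
    (intervalIntegrable_of_monotoneOn_Ici (hG l) le_rfl (hz l))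
    (intervalIntegrable_of_monotoneOn_Ici (hH l) le_rfl (hz l)) fun s hs => h l s hs.1

theorem potential_sub {G : E → ℝ → ℝ} (hG : ∀ l, MonotoneOn (G l) (Ici 0)) {z z' : E → ℝ}
    (hz : ∀ l, 0 ≤ z l) (hz' : ∀ l, 0 ≤ z' l) :
    potential G z' - potential G z = ∑ l, ∫ s in z l..z' l, G l s := by
  rw [potential, potential, ← Finset.sum_sub_distrib]
  exact Finset.sum_congr rfl fun l _ => intervalIntegral.integral_interval_sub_left
    (intervalIntegrable_of_monotoneOn_Ici (hG l) le_rfl (hz' l))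
    (intervalIntegrable_of_monotoneOn_Ici (hG l) le_rfl (hz l))

theorem sum_mul_sub_le_potential_sub {G : E → ℝ → ℝ} (hG : ∀ l, MonotoneOn (G l) (Ici 0))
    {z z' p : E → ℝ} (hp : ∀ l, PriceBetween (G l) (z l) (p l)) (hz : ∀ l, 0 ≤ z l)
    (hz' : ∀ l, 0 ≤ z' l) : ∑ l, p l * (z' l - z l) ≤ potential G z' - potential G z := by
  rw [potential_sub hG hz hz']
  exact Finset.sum_le_sum fun l _ => (hp l).mul_sub_le_integral (hG l) (hz l) (hz' l)

/-- Strict convexity: the subgradient inequality is an equality only at the base point. -/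
theorem eq_of_potential_sub_le {G : E → ℝ → ℝ} (hG : ∀ l, StrictMonoOn (G l) (Ici 0))
    {z z' p : E → ℝ} (hp : ∀ l, PriceBetween (G l) (z l) (p l)) (hz : ∀ l, 0 ≤ z l)
    (hz' : ∀ l, 0 ≤ z' l) (h : potential G z' - potential G z ≤ ∑ l, p l * (z' l - z l)) :
    z' = z := by
  rw [potential_sub (fun l => (hG l).monotoneOn) hz hz'] at h
  have hle : ∀ l ∈ Finset.univ, p l * (z' l - z l) ≤ ∫ s in z l..z' l, G l s := fun l _ =>
    (hp l).mul_sub_le_integral (hG l).monotoneOn (hz l) (hz' l)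
  have heq := (Finset.sum_eq_sum_iff_of_le hle).1 (le_antisymm (Finset.sum_le_sum hle) h)
  funext l
  by_contra hne
  exact ((hp l).mul_sub_lt_integral (hG l) (hz l) (hz' l) (Ne.symm hne)).ne
    (heq l (Finset.mem_univ l))

theorem tendsto_potential {G : ℕ → E → ℝ → ℝ} {Y : E → ℝ → ℝ} {z B : E → ℝ}
    (hG : ∀ n l, MonotoneOn (G n l) (Ici 0)) (hG0 : ∀ n l s, 0 ≤ s → 0 ≤ G n l s)
    (hB : ∀ n l, G n l (z l) ≤ B l)
    (h : ∀ l s, 0 ≤ s → Tendsto (fun n => G n l s) atTop (𝓝 (Y l s))) (hz : ∀ l, 0 ≤ z l) :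
    Tendsto (fun n => potential (G n) z) atTop (𝓝 (potential Y z)) := by
  refine tendsto_finsetSum _ fun l _ =>
    intervalIntegral.tendsto_integral_filter_of_dominated_convergence (fun _ => B l) ?_ ?_
      intervalIntegrable_const ?_
  · exact Eventually.of_forall fun n => (intervalIntegrable_iff.1
      (intervalIntegrable_of_monotoneOn_Ici (hG n l) le_rfl (hz l))).aestronglyMeasurable
  · refine Eventually.of_forall fun n => Eventually.of_forall fun s hs => ?_
    rw [uIoc_of_le (hz l)] at hs
    rw [Real.norm_of_nonneg (hG0 n l s hs.1.le)]
    exact (hG n l hs.1.le (hz l) hs.2).trans (hB n l)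
  · refine Eventually.of_forall fun s hs => ?_
    rw [uIoc_of_le (hz l)] at hs
    exact h l s hs.1.le

end Potential

namespace InBandNetwork

variable {V Lv Lw ι : Type*} {Path : ι → Type*} {N : InBandNetwork V Lv Lw ι Path}

namespace IsSolution

variable [Fintype ι] [∀ i, Fintype (Path i)]
  {r : ℝ → ∀ i, Path i → ℝ} {x : ℝ → Lw → ℝ}

/-! ### Bounds uniform in time -/

/-- The extra `1` provides a rate strictly above all link rates; the price there bounds even the
values used at a jump. -/
theorem linkRate_mem (hsol : N.IsSolution r x) {t : ℝ} (ht : 0 ≤ t) (l : Lv ⊕ Lw) :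
    N.linkRate (r t) l ∈ Ico 0 (∑ i, |N.rate i| + 1) :=
  ⟨N.linkRate_nonneg (hsol.feasible ht).1 l, by
    have h1 := (hsol.feasible ht).linkRate_le N l
    have h2 := Finset.sum_le_sum fun i (_ : i ∈ Finset.univ) => le_abs_self (N.rate i)
    linarith⟩

variable [Fintype V]

theorem price_le_initial_price (hN : N.Standing) (hsol : N.IsSolution r x) {t s : ℝ} (ht : 0 ≤ t)
    (hs : 0 ≤ s) (hs' : s ≤ ∑ i, |N.rate i| + 1) (l : Lv ⊕ Lw) :
    N.price (x t) l s ≤ N.price (x 0) l (∑ i, |N.rate i| + 1) :=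
  (hsol.price_antitone hN l hs self_mem_Ici ht ht).trans
    ((N.strictMonoOn_price hN (hsol.fraction 0 le_rfl) l).monotoneOn hs (hs.trans hs') hs')

theorem priceBetween_of_mem (hN : N.Standing) (hsol : N.IsSolution r x) {t : ℝ} (ht : 0 ≤ t)
    {p : Lv ⊕ Lw → ℝ} (hp : ∀ l, p l ∈ N.priceSet (N.linkRate (r t) l) (x t) l) (l : Lv ⊕ Lw) :
    PriceBetween (N.price (x t) l) (N.linkRate (r t) l) (p l) :=
  PriceBetween.of_mem_krasovskii (N.strictMonoOn_price hN (hsol.fraction t ht) l).monotoneOn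
    (N.priceSet_eq _ _ _ ▸ hp l)

theorem mem_Icc_of_mem_priceSet (hN : N.Standing) (hsol : N.IsSolution r x) {t : ℝ} (ht : 0 ≤ t)
    {p : Lv ⊕ Lw → ℝ} (hp : ∀ l, p l ∈ N.priceSet (N.linkRate (r t) l) (x t) l) (l : Lv ⊕ Lw) :
    p l ∈ Icc 0 (N.price (x 0) l (∑ i, |N.rate i| + 1)) := by
  refine ⟨ge_of_mem_krasovskii (N.priceSet_eq _ _ _ ▸ hp l) one_pos fun b hb _ =>
    N.price_nonneg hN (hsol.fraction t ht) l hb, ?_⟩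
  exact ((hsol.priceBetween_of_mem hN ht hp l).2 _ (hsol.linkRate_mem ht l).2).trans
    (hsol.price_le_initial_price hN ht (by positivity) le_rfl l)

variable [Fintype Lv] [Fintype Lw]

/-- An upper bound for the link prices and path delays along a solution that starts at the
fractions `ξ` of compromised nodes. -/
def priceBound (N : InBandNetwork V Lv Lw ι Path) (ξ : Lw → ℝ) : ℝ :=
  ∑ l, N.price ξ l (∑ i, |N.rate i| + 1)

theorem pathDelay_mem (hN : N.Standing) (hsol : N.IsSolution r x) {t : ℝ} (ht : 0 ≤ t)
    {p : Lv ⊕ Lw → ℝ} (hp : ∀ l, p l ∈ N.priceSet (N.linkRate (r t) l) (x t) l) (i : ι)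
    (P : Path i) : N.pathDelay p i P ∈ Icc 0 (priceBound N (x 0)) := by
  have h := hsol.mem_Icc_of_mem_priceSet hN ht hp
  exact ⟨Finset.sum_nonneg fun l _ => (h l).1,
    (Finset.sum_le_univ_sum_of_nonneg fun l => (h l).1).trans
      (Finset.sum_le_sum fun l _ => (h l).2)⟩

theorem exists_lipschitz_linkRate (hN : N.Standing) (hsol : N.IsSolution r x) :
    ∃ C, ∀ s t, 0 ≤ s → s ≤ t → ∀ l,
      |N.linkRate (r t) l - N.linkRate (r s) l| ≤ C * (t - s) := by
  refine ⟨∑ i, ∑ _P : Path i, Fintype.card (Path i) * priceBound N (x 0),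
    fun s t hs hst l => ?_⟩
  rw [← linkRate_sub, Finset.sum_mul]
  refine (N.abs_linkRate_le _ l).trans (Finset.sum_le_sum fun i _ => ?_)
  rw [Finset.sum_mul]
  refine Finset.sum_le_sum fun P _ => ?_
  have hac := hsol.absCont_clm (pathRate i P) hs (hs.trans hst)
  have hder : ∀ᵐ τ, τ ∈ Ioc s t → |deriv (fun τ => pathRate i P (r τ)) τ| ≤
      Fintype.card (Path i) * priceBound N (x 0) := by
    filter_upwards [hsol.ae_flow] with τ hτ hτ0
    have hτ' : 0 ≤ τ := hs.trans hτ0.1.le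
    obtain ⟨p, hp, v, hv, hvel⟩ := hτ hτ'
    have hd : HasDerivAt (fun τ => pathRate i P (r τ)) (pathRate i P v) τ :=
      (pathRate i P).hasFDerivAt.comp_hasDerivAt τ hv
    rw [hd.deriv]
    exact abs_le_of_mem_flowVelocities (hsol.pathDelay_mem hN hτ' hp i) (hvel i) P
  have h1 := hac.sub_le_of_deriv_le hst (hder.mono fun τ h hτ => (abs_le.1 (h hτ)).2)
  have h2 := hac.le_sub_of_le_deriv hst (hder.mono fun τ h hτ => (abs_le.1 (h hτ)).1)
  rw [abs_le, ← neg_mul]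
  exact ⟨h2, h1⟩

/-! ### Decrease of the potential along a solution -/

/-- The potential of the current prices at the current link rates. -/
def energy (N : InBandNetwork V Lv Lw ι Path) (r : ℝ → ∀ i, Path i → ℝ) (x : ℝ → Lw → ℝ)
    (t : ℝ) : ℝ :=
  potential (N.price (x t)) (N.linkRate (r t))

theorem energy_nonneg (hN : N.Standing) (hsol : N.IsSolution r x) {t : ℝ} (ht : 0 ≤ t) :
    0 ≤ energy N r x t :=
  potential_nonneg (fun l _ hs => N.price_nonneg hN (hsol.fraction t ht) l hs)
    fun l => (hsol.linkRate_mem ht l).1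

/-- The intermediate quantity is the potential of the later prices at the earlier rates: falling
prices compare it with the earlier energy, convexity with the later one. -/
theorem energy_sub_le (hN : N.Standing) (hsol : N.IsSolution r x) {s t : ℝ} (hs : 0 ≤ s)
    (hst : s ≤ t) {p : Lv ⊕ Lw → ℝ}
    (hp : ∀ l, PriceBetween (N.price (x t) l) (N.linkRate (r t) l) (p l)) :
    energy N r x t - energy N r x s ≤
      ∑ l, p l * (N.linkRate (r t) l - N.linkRate (r s) l) := by
  have ht := hs.trans hst
  have hmono : ∀ {τ}, 0 ≤ τ → ∀ l, MonotoneOn (N.price (x τ) l) (Ici 0) := fun hτ l =>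
    (N.strictMonoOn_price hN (hsol.fraction _ hτ) l).monotoneOn
  have hz : ∀ {τ}, 0 ≤ τ → ∀ l, 0 ≤ N.linkRate (r τ) l := fun hτ l => (hsol.linkRate_mem hτ l).1
  have h1 := sum_mul_sub_le_potential_sub (hmono ht) hp (hz ht) (hz hs)
  have h2 : potential (N.price (x t)) (N.linkRate (r s)) ≤ energy N r x s :=
    potential_mono (hmono ht) (hmono hs)
      (fun l u hu => hsol.price_antitone hN l hu hs ht hst) (hz hs)
  have h3 : ∑ l, p l * (N.linkRate (r t) l - N.linkRate (r s) l) =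
      -∑ l, p l * (N.linkRate (r s) l - N.linkRate (r t) l) := by
    rw [← Finset.sum_neg_distrib]
    exact Finset.sum_congr rfl fun l _ => by ring
  unfold energy at h2 ⊢
  linarith

/-- The total dissipation of all sources under the link prices `p`. -/
def totalDissipation (N : InBandNetwork V Lv Lw ι Path) (p : Lv ⊕ Lw → ℝ)
    (ρ : ∀ i, Path i → ℝ) : ℝ :=
  ∑ i, dissipation (N.pathDelay p i) (ρ i)

/-- Left difference quotients are used because `energy_sub_le` holds with prices at the later time.
-/
theorem deriv_energy_le (hN : N.Standing) (hsol : N.IsSolution r x) {t d : ℝ} (ht : 0 < t)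
    {p : Lv ⊕ Lw → ℝ} (hp : ∀ l, p l ∈ N.priceSet (N.linkRate (r t) l) (x t) l)
    {v : ∀ i, Path i → ℝ} (hv : HasDerivAt r v t)
    (hvel : ∀ i, v i ∈ flowVelocities (N.pathDelay p i) (r t i))
    (hd : HasDerivAt (energy N r x) d t) : d ≤ -totalDissipation N p (r t) := by
  have hz : HasDerivAt (fun τ => ∑ l, p l * N.linkRate (r τ) l) (∑ l, p l * N.linkRate v l) t :=
    HasDerivAt.fun_sum fun l _ => (N.hasDerivAt_linkRate hv l).const_mul _
  have h1 : d ≤ ∑ l, p l * N.linkRate v l := by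
    have hsub : Iio t ⊆ {t}ᶜ := fun s hs => hs.ne
    have hld := (hasDerivAt_iff_tendsto_slope.1 hd).mono_left (nhdsWithin_mono t hsub)
    have hlz := (hasDerivAt_iff_tendsto_slope.1 hz).mono_left (nhdsWithin_mono t hsub)
    refine le_of_tendsto_of_tendsto hld hlz ?_
    filter_upwards [Ioo_mem_nhdsLT ht] with s hs
    have := hsol.energy_sub_le hN hs.1.le hs.2.le (hsol.priceBetween_of_mem hN ht.le hp)
    rw [slope_comm, slope_comm _ t, slope_def_field, slope_def_field,
      ← Finset.sum_sub_distrib]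
    simp only [← mul_sub]
    exact div_le_div_of_nonneg_right this (sub_nonneg.2 hs.2.le)
  refine h1.trans ?_
  rw [sum_mul_linkRate, totalDissipation, ← Finset.sum_neg_distrib]
  exact Finset.sum_le_sum fun i _ => sum_mul_le_neg_dissipation (hvel i)

theorem energy_sub_le_of_le_totalDissipation (hN : N.Standing) (hsol : N.IsSolution r x)
    {a b c : ℝ} (ha : 0 ≤ a) (hab : a ≤ b)
    (h : ∀ t ∈ Ioo a b, ∀ p : Lv ⊕ Lw → ℝ,
      (∀ l, p l ∈ N.priceSet (N.linkRate (r t) l) (x t) l) → c ≤ totalDissipation N p (r t)) :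
    energy N r x b - energy N r x a ≤ -c * (b - a) := by
  obtain ⟨C, hC⟩ := hsol.exists_lipschitz_linkRate hN
  refine sub_le_of_ae_deriv_le (C := priceBound N (x 0) * C) hab (fun s hs t ht hst => ?_) ?_
  · have hs0 := ha.trans hs.1
    have ht0 := hs0.trans hst
    refine (hsol.energy_sub_le hN hs0 hst fun l => PriceBetween.self
      (N.strictMonoOn_price hN (hsol.fraction t ht0) l).monotoneOn
      (hsol.linkRate_mem ht0 l).1).trans ?_
    rw [priceBound, mul_assoc, Finset.sum_mul]
    refine Finset.sum_le_sum fun l _ => ?_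
    have hz := hsol.linkRate_mem ht0 l
    have hp0 := N.price_nonneg hN (hsol.fraction t ht0) l hz.1
    refine (mul_le_mul_of_nonneg_left ((le_abs_self _).trans (hC s t hs0 hst l)) hp0).trans ?_
    exact mul_le_mul_of_nonneg_right (hsol.price_le_initial_price hN ht0 hz.1 hz.2.le l)
      ((abs_nonneg _).trans (hC s t hs0 hst l))
  · filter_upwards [hsol.ae_flow] with t ht htab d hd
    have ht0 := ha.trans_lt htab.1
    obtain ⟨p, hp, v, hv, hvel⟩ := ht ht0.le
    have h1 := hsol.deriv_energy_le hN ht0 hp hv hvel hd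
    have h2 := h t htab p hp
    linarith

theorem energy_antitone (hN : N.Standing) (hsol : N.IsSolution r x) {s t : ℝ} (hs : 0 ≤ s)
    (hst : s ≤ t) : energy N r x t ≤ energy N r x s := by
  have := hsol.energy_sub_le_of_le_totalDissipation hN (c := 0) hs hst fun τ _ p _ =>
    Finset.sum_nonneg fun i _ => dissipation_nonneg _ _
  linarith

theorem exists_totalDissipation_lt (hN : N.Standing) (hsol : N.IsSolution r x) {T ε : ℝ}
    (hT : 0 ≤ T) (hε : 0 < ε) : ∃ t, T ≤ t ∧ ∃ p : Lv ⊕ Lw → ℝ,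
      (∀ l, p l ∈ N.priceSet (N.linkRate (r t) l) (x t) l) ∧ totalDissipation N p (r t) < ε := by
  by_contra! hcon
  have hU := hsol.energy_nonneg hN hT
  -- Losing `ε` per unit of time up to `b` would make the energy negative.
  set b := T + (energy N r x T + 1) / ε with hb
  have hTb : T ≤ b := by
    have : 0 ≤ (energy N r x T + 1) / ε := by positivity
    linarith
  have h1 := hsol.energy_sub_le_of_le_totalDissipation hN (c := ε) hT hTb
    fun t ht p hp => hcon t ht.1.le p hp
  have h2 := hsol.energy_nonneg hN (hT.trans hTb)
  have h3 : -ε * (b - T) = -(energy N r x T + 1) := by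
    rw [hb]; field_simp; ring
  linarith

/-- Along a suitable sequence of times, flow allocation and prices converge to a Wardrop
equilibrium. -/
theorem exists_seq_tendsto_isWardrop (hN : N.Standing) (hsol : N.IsSolution r x) :
    ∃ (t : ℕ → ℝ) (p : ℕ → Lv ⊕ Lw → ℝ) (rs : ∀ i, Path i → ℝ) (ps : Lv ⊕ Lw → ℝ),
      (∀ n, 0 ≤ t n) ∧ Tendsto t atTop atTop ∧
      (∀ n l, p n l ∈ N.priceSet (N.linkRate (r (t n)) l) (x (t n)) l) ∧
      Tendsto (fun n => r (t n)) atTop (𝓝 rs) ∧ Tendsto p atTop (𝓝 ps) ∧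
      N.Feasible rs ∧ ∀ i, IsWardrop (N.pathDelay ps i) (rs i) := by
  choose t ht p hp hD using fun n : ℕ =>
    hsol.exists_totalDissipation_lt hN (Nat.cast_nonneg n) (Nat.one_div_pos_of_nat (n := n) (α := ℝ))
  have ht0 : ∀ n, 0 ≤ t n := fun n => (Nat.cast_nonneg n).trans (ht n)
  have htop : Tendsto t atTop atTop := tendsto_atTop_mono ht tendsto_natCast_atTop_atTop
  obtain ⟨⟨rs, ps⟩, ⟨hrs, -⟩, φ, hφ, hlim⟩ := (N.isCompact_feasible.prod
    (isCompact_univ_pi fun l => isCompact_Icc (a := (0 : ℝ))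
      (b := N.price (x 0) l (∑ i, |N.rate i| + 1)))).tendsto_subseq
    (x := fun n => (r (t n), p n))
    fun n => ⟨hsol.feasible (ht0 n), fun l _ => hsol.mem_Icc_of_mem_priceSet hN (ht0 n) (hp n) l⟩
  have hr : Tendsto (fun n => r (t (φ n))) atTop (𝓝 rs) := (continuous_fst.tendsto _).comp hlim
  have hpl : Tendsto (fun n => p (φ n)) atTop (𝓝 ps) := (continuous_snd.tendsto _).comp hlim
  refine ⟨fun n => t (φ n), fun n => p (φ n), rs, ps, fun n => ht0 _, htop.comp hφ.tendsto_atTop,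
    fun n => hp _, hr, hpl, hrs, fun i P hP P' => ?_⟩
  have hq : ∀ P, Tendsto (fun n => N.pathDelay (p (φ n)) i P) atTop (𝓝 (N.pathDelay ps i P)) :=
    fun P => tendsto_finsetSum _ fun l _ => tendsto_pi_nhds.1 hpl l
  have h0 : Tendsto (fun n => √(1 / ((φ n : ℝ) + 1))) atTop (𝓝 0) := by
    have := ((Real.continuous_sqrt.tendsto 0).comp
      (tendsto_one_div_add_atTop_nhds_zero_nat (𝕜 := ℝ))).comp hφ.tendsto_atTop
    rwa [Real.sqrt_zero] at this
  -- A path used in the limit is eventually used, so its excess delay is at most the root of the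
  -- dissipation.
  have hpos : ∀ᶠ n in atTop, 0 < r (t (φ n)) i P :=
    (tendsto_pi_nhds.1 (tendsto_pi_nhds.1 hr i) P).eventually (lt_mem_nhds hP)
  have := le_of_tendsto_of_tendsto ((hq P).sub (hq P')) h0 (by
    filter_upwards [hpos] with n hn
    have h1 : ⨅ P, N.pathDelay (p (φ n)) i P ≤ N.pathDelay (p (φ n)) i P' :=
      ciInf_le (finite_range _).bddBelow P'
    refine (sub_le_sub_left h1 _).trans (Real.le_sqrt_of_sq_le ?_)
    refine (sq_le_dissipation hn).trans (le_trans ?_ (hD (φ n)).le)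
    exact Finset.single_le_sum
      (f := fun i => dissipation (N.pathDelay (p (φ n)) i) (r (t (φ n)) i))
      (fun i _ => dissipation_nonneg _ _) (Finset.mem_univ i))
  linarith

/-! ### Convergence of the link rates along the whole trajectory -/

theorem tendsto_linkRate (hN : N.Standing) (hsol : N.IsSolution r x) {Y : Lv ⊕ Lw → ℝ → ℝ}
    (hY : ∀ l s, 0 ≤ s → Tendsto (fun t => N.price (x t) l s) atTop (𝓝 (Y l s)))
    (hYle : ∀ l s t, 0 ≤ s → 0 ≤ t → Y l s ≤ N.price (x t) l s)
    (hYmono : ∀ l, StrictMonoOn (Y l) (Ici 0))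
    {t : ℕ → ℝ} {p : ℕ → Lv ⊕ Lw → ℝ} {rs : ∀ i, Path i → ℝ} {ps : Lv ⊕ Lw → ℝ}
    (ht0 : ∀ n, 0 ≤ t n) (ht : Tendsto t atTop atTop)
    (hp : ∀ n l, p n l ∈ N.priceSet (N.linkRate (r (t n)) l) (x (t n)) l)
    (hr : Tendsto (fun n => r (t n)) atTop (𝓝 rs)) (hps : Tendsto p atTop (𝓝 ps))
    (hrs : N.Feasible rs) (hw : ∀ i, IsWardrop (N.pathDelay ps i) (rs i)) (l : Lv ⊕ Lw) :
    Tendsto (fun t => N.linkRate (r t) l) atTop (𝓝 (N.linkRate rs l)) := by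
  have hz : ∀ l, Tendsto (fun n => N.linkRate (r (t n)) l) atTop (𝓝 (N.linkRate rs l)) :=
    fun l => ((N.continuous_linkRate l).tendsto rs).comp hr
  have hzs : ∀ l, 0 ≤ N.linkRate rs l := N.linkRate_nonneg hrs.1
  have hmono : ∀ {τ}, 0 ≤ τ → ∀ l, MonotoneOn (N.price (x τ) l) (Ici 0) := fun hτ l =>
    (N.strictMonoOn_price hN (hsol.fraction _ hτ) l).monotoneOn
  have hpb : ∀ n l, PriceBetween (N.price (x (t n)) l) (N.linkRate (r (t n)) l) (p n l) :=
    fun n => hsol.priceBetween_of_mem hN (ht0 n) (hp n)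
  have hps' : ∀ l, PriceBetween (Y l) (N.linkRate rs l) (ps l) := fun l =>
    PriceBetween.of_tendsto (fun s hs => (hY l s hs).comp ht) (hzs l) (hz l)
      (tendsto_pi_nhds.1 hps l) fun n => hpb n l
  -- By convexity these expressions bound the energy at `t n` from above, with no need for the
  -- energy itself to converge to the limit potential.
  have hupper : Tendsto (fun n => potential (N.price (x (t n))) (N.linkRate rs) -
      ∑ l, p n l * (N.linkRate rs l - N.linkRate (r (t n)) l)) atTop
      (𝓝 (potential Y (N.linkRate rs))) := by
    have h1 := tendsto_potential (z := N.linkRate rs) (Y := Y)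
      (B := fun l => N.price (x 0) l (N.linkRate rs l))
      (fun n => hmono (ht0 n))
      (fun n l s hs => N.price_nonneg hN (hsol.fraction _ (ht0 n)) l hs)
      (fun n l => hsol.price_antitone hN l (hzs l) self_mem_Ici (ht0 n) (ht0 n))
      (fun l s hs => (hY l s hs).comp ht) hzs
    have h2 : Tendsto (fun n => ∑ l, p n l * (N.linkRate rs l - N.linkRate (r (t n)) l)) atTop
        (𝓝 (∑ l, ps l * (N.linkRate rs l - N.linkRate rs l))) :=
      tendsto_finsetSum _ fun l _ =>
        (tendsto_pi_nhds.1 hps l).mul (tendsto_const_nhds.sub (hz l))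
    simpa using h1.sub h2
  have hev : ∀ ε > 0, ∀ᶠ τ in atTop,
      potential Y (N.linkRate (r τ)) ≤ potential Y (N.linkRate rs) + ε := by
    intro ε hε
    obtain ⟨n, hn⟩ := (hupper.eventually (gt_mem_nhds (lt_add_of_pos_right _ hε))).exists
    filter_upwards [eventually_ge_atTop (t n)] with τ hτ
    have hτ0 := (ht0 n).trans hτ
    have h1 : potential Y (N.linkRate (r τ)) ≤ energy N r x τ :=
      potential_mono (fun l => (hYmono l).monotoneOn) (hmono hτ0)
        (fun l s hs => hYle l s τ hs hτ0) fun l => (hsol.linkRate_mem hτ0 l).1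
    have h2 := hsol.energy_antitone hN (ht0 n) hτ
    have h3 := sum_mul_sub_le_potential_sub (hmono (ht0 n)) (hpb n)
      (fun l => (hsol.linkRate_mem (ht0 n) l).1) hzs
    unfold energy at h1 h2
    linarith
  refine tendsto_iff_ultrafilter _ _ _ |>.2 fun g hg => ?_
  obtain ⟨r', hr', hgr⟩ := N.isCompact_feasible.ultrafilter_le_nhds (g.map r) (by
    rw [le_principal_iff]
    exact hg ((eventually_ge_atTop 0).mono fun τ hτ => hsol.feasible hτ))
  have hgr' : Tendsto r g (𝓝 r') := hgr
  have hzl : ∀ l, Tendsto (fun τ => N.linkRate (r τ) l) g (𝓝 (N.linkRate r' l)) := fun l =>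
    ((N.continuous_linkRate l).tendsto r').comp hgr'
  have hz' : ∀ l, 0 ≤ N.linkRate r' l := N.linkRate_nonneg hr'.1
  have hle : potential Y (N.linkRate r') ≤ potential Y (N.linkRate rs) := by
    refine le_of_forall_pos_le_add fun ε hε => ?_
    -- Lower semicontinuity of the potential, through its affine minorant at the cluster point.
    have hlin : Tendsto (fun τ => potential Y (N.linkRate r') +
        ∑ l, Y l (N.linkRate r' l) * (N.linkRate (r τ) l - N.linkRate r' l)) g
        (𝓝 (potential Y (N.linkRate r') +
          ∑ l, Y l (N.linkRate r' l) * (N.linkRate r' l - N.linkRate r' l))) :=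
      tendsto_const_nhds.add (tendsto_finsetSum _ fun l _ =>
        tendsto_const_nhds.mul ((hzl l).sub tendsto_const_nhds))
    simp only [sub_self, mul_zero, Finset.sum_const_zero, add_zero] at hlin
    refine le_of_tendsto hlin (hg ?_)
    filter_upwards [hev ε hε, eventually_ge_atTop 0] with τ hτ hτ0
    have := sum_mul_sub_le_potential_sub (fun l => (hYmono l).monotoneOn)
      (fun l => PriceBetween.self (hYmono l).monotoneOn (hz' l)) hz'
      fun l => (hsol.linkRate_mem hτ0 l).1
    linarith
  -- The subgradient `ps` is nonnegative towards `r'`, whose potential is no larger; strict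
  -- convexity forces equal link rates.
  have hvi := N.sum_mul_linkRate_le_of_isWardrop hrs hr' hw
  have heq : N.linkRate r' = N.linkRate rs :=
    eq_of_potential_sub_le hYmono hps' hzs hz' (by
      simp only [mul_sub, Finset.sum_sub_distrib]
      linarith)
  have := hzl l
  rwa [heq] at this

end IsSolution
end InBandNetwork

/-- A trajectory in a compact set along which continuous functions converge approaches their
common level set. -/
theorem tendsto_infDist_of_isCompact {X ι E : Type*} [PseudoMetricSpace X] [TopologicalSpace E]
    [T2Space E] {K : Set X} (hK : IsCompact K) {F : ι → X → E} (hF : ∀ l, Continuous (F l))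
    {r : ℝ → X} {z : ι → E} (hr : ∀ᶠ t in atTop, r t ∈ K)
    (h : ∀ l, Tendsto (fun t => F l (r t)) atTop (𝓝 (z l))) {A : Set X}
    (hA : ∀ y ∈ K, (∀ l, F l y = z l) → y ∈ A) :
    Tendsto (fun t => Metric.infDist (r t) A) atTop (𝓝 0) := by
  refine tendsto_iff_ultrafilter _ _ _ |>.2 fun g hg => ?_
  obtain ⟨y, hy, hgy⟩ := hK.ultrafilter_le_nhds (g.map r) (by
    rw [le_principal_iff]
    exact hg hr)
  have hgy' : Tendsto r g (𝓝 y) := hgy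
  have hyA : y ∈ A := hA y hy fun l =>
    tendsto_nhds_unique (((hF l).tendsto y).comp hgy') ((h l).mono_left hg)
  have := ((Metric.continuous_infDist_pt A).tendsto y).comp hgy'
  rwa [Metric.infDist_zero_of_mem hyA] at this

end

/-! ### Assembly of the theorem -/

theorem mainTheorem4 {V Lv Lw ι : Type*} {Path : ι → Type*}
    [Fintype V] [Fintype Lv] [Fintype Lw] [Fintype ι]
    [∀ i, Fintype (Path i)] [∀ i, Nonempty (Path i)]
    (N : InBandNetwork V Lv Lw ι Path) (hN : N.Standing)
    (r : ℝ → ∀ i, Path i → ℝ) (x : ℝ → Lw → ℝ) (hsol : N.IsSolution r x) :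
    ∃ (rs : ∀ i, Path i → ℝ) (xs : Lw → ℝ),
      N.IsEquilibrium rs xs ∧
      Tendsto x atTop (𝓝 xs) ∧
      (∀ l, Tendsto (fun t => N.linkRate (r t) l) atTop (𝓝 (N.linkRate rs l))) ∧
      Tendsto (fun t => Metric.infDist (r t)
        {r' | N.IsEquilibrium r' xs ∧ N.linkRate r' = N.linkRate rs}) atTop (𝓝 0) ∧
      ((∀ r', N.IsEquilibrium r' xs → N.linkRate r' = N.linkRate rs → r' = rs) →
        ∀ i, Tendsto (fun t => r t i) atTop (𝓝 (rs i))) ∧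
      (N.NonSwitching xs →
        ∀ r', N.IsEquilibrium r' xs → N.linkRate r' = N.linkRate rs) := by
  obtain ⟨xs, hxs, hx⟩ := hsol.exists_tendsto_fraction hN
  obtain ⟨Y, hY, hYle, hYmono⟩ := hsol.exists_limit_price hN (fun l => (hxs l).1) hx
  obtain ⟨t, p, rs, ps, ht0, ht, hp, hr, hps, hrs, hw⟩ := hsol.exists_seq_tendsto_isWardrop hN
  have hz := hsol.tendsto_linkRate hN hY hYle hYmono ht0 ht hp hr hps hrs hw
  have hmem : ∀ l, ps l ∈ N.steadyPriceSet (N.linkRate rs l) xs l := fun l =>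
    N.mem_steadyPriceSet_of_tendsto l (fun n l => hsol.fraction _ (ht0 n) l)
      ((hz l).comp ht) (hx.comp ht) (tendsto_pi_nhds.1 hps l) fun n => hp n l
  have hdist : Tendsto (fun t => Metric.infDist (r t)
      {r' | N.IsEquilibrium r' xs ∧ N.linkRate r' = N.linkRate rs}) atTop (𝓝 0) := by
    refine tendsto_infDist_of_isCompact N.isCompact_feasible N.continuous_linkRate
      ((eventually_ge_atTop 0).mono fun t ht => hsol.feasible ht) hz fun r' hr' h => ?_
    have h' : N.linkRate r' = N.linkRate rs := funext h
    -- The same limit prices `ps` serve every feasible flow with these link rates.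
    exact ⟨⟨hxs, hr', ps, fun l => by rw [h']; exact hmem l,
      N.isWardrop_of_linkRate_eq hrs hr' hw h'⟩, h'⟩
  have heq : N.IsEquilibrium rs xs := ⟨hxs, hrs, ps, hmem, hw⟩
  refine ⟨rs, xs, heq, hx, hz, hdist, fun huniq i => ?_, fun hns r' hr' => ?_⟩
  · have hA : {r' | N.IsEquilibrium r' xs ∧ N.linkRate r' = N.linkRate rs} = {rs} :=
      Subset.antisymm (fun r' h => huniq r' h.1 h.2) (singleton_subset_iff.2 ⟨heq, rfl⟩)
    rw [hA] at hdist
    simp only [Metric.infDist_singleton] at hdist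
    exact tendsto_pi_nhds.1 (tendsto_iff_dist_tendsto_zero.2 hdist) i
  · obtain ⟨-, hfeas, p', hp', hw'⟩ := hr'
    have hxs' := fun l => (hxs l).1
    -- Here the monotone graph is that of the price at `xs`, not the limit `Y`.
    exact N.linkRate_eq_of_isWardrop (N.strictMonoOn_price hN hxs') hrs hfeas hw hw'
      (fun l => N.priceBetween_of_nonSwitching hN hxs' hns (N.linkRate_nonneg hrs.1 l) (hmem l))
      fun l => N.priceBetween_of_nonSwitching hN hxs' hns (N.linkRate_nonneg hfeas.1 l) (hp' l)
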